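/- Let $\mathbb T=\mathbb R/\mathbb Z$. For $\omega\in\{0,1,2,3\}$ let $f_\omega:\mathbb T\to\mathbb T$ be given by $f_\omega(x)=\frac x2+\frac\omega4$ for $x\in[0,\frac12]$ and $f_\omega(x)=\frac{1-x}2+\frac\omega4$ for $x\in[\frac12,1]$, and let $h_\omega(x,y)=\sin 2\pi y-\sin 2\pi x-\frac{\omega}{3.6}$. For an integer $L\ge 1$ and $\alpha>0$, consider the star network with $N=L+1$ nodes, the hub $z=x_1$ and the low-degree nodes $x_2,\dots,x_N$: $$z^{t+1}=f_{\boldsymbol\omega_1^t}(z^t)+\frac{\alpha}{L}\sum_{j=2}^{N}h_{\boldsymbol\omega_1^t}(z^t,x_j^t)\bmod 1,\qquad x_j^{t+1}=f_{\boldsymbol\omega_j^t}(x_j^t)+\frac{\alpha}{L}h_{\boldsymbol\omega_j^t}(x_j^t,z^t)\bmod 1\quad(2\le j\le N).$$ Let $\mathrm{Prob}$ be the law of $(\boldsymbol\omega,x)\in\{0,1,2,3\}^{\mathbb N\times N}\times\mathbb T^N$ under which the noise symbols $\boldsymbol\omega_i^t$ ($t\ge0$, $1\le i\le N$) are i.i.d.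 uniform on $\{0,1,2,3\}$ and the initial state $x=(z^0,x_2^0,\dots,x_N^0)$ is uniform on $\mathbb T^N$ and independent of the noise. Put $$f_{\alpha,\omega}(z)=f_\omega(z)+\alpha\int_{\mathbb T}h_\omega(z,y)\,dy\bmod 1,\qquad \xi^t=\xi^t(\boldsymbol\omega,x)=\frac{\alpha}{L}\sum_{j=2}^{N}\sin 2\pi x_j^t .$$ **Theorem A.** There are absolute constants $C_1,C_2,C_3>0$ such that for all integers $L\ge C_1$ and all $\alpha>0$ with $L^{1/2}/\alpha\ge C_2$ the hub satisfies $z^{t+1}=f_{\alpha,\boldsymbol\omega_1^t}(z^t)+\xi^t \bmod 1$ for every $t\ge0$ and every $(\boldsymbol\omega,x)$, and the following hold. (i) For every $\varepsilon$ with $\varepsilon L^{1/2}/\alpha\ge C_3$, $$\mathrm{Prob}\Big\{\liminf_{T\to\infty}\frac1T\sum_{t=0}^{T-1}\mathbb 1_{|\xi^t|\le\varepsilon}\ \ge\ 1-\exp\big(-L\varepsilon^2/(9\alpha^2)\big)\Big\}=1 .$$ (ii) For every $\kappa\in(0,\frac12)$, every $t_0\in\mathbb N$ and every integer $0\le T\le\lceil\exp(L^{1-2\kappa})\rceil$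 (in particular for a window length $T\ge\exp(L^{1-2\kappa})$, namely $T=\lceil\exp(L^{1-2\kappa})\rceil$), $$\mathrm{Prob}\big\{|\xi^t|\le 3\alpha L^{-\kappa}\ \text{ for all } t\in\{t_0,\dots,t_0+T-1\}\big\}\ \ge\ 1-\exp(-L^{1-2\kappa}).$$ (iii) For every $t\in\mathbb N$ and $s\in\mathbb R$, $$F_L(s-c_1)-c_2\ \le\ \mathrm{Prob}\{\xi^t\le s\}\ \le\ F_L(s+c_1)+c_2,\qquad c_1=36\alpha^2/L,\quad c_2=8/\sqrt L,$$ where $F_L$ is the cumulative distribution function of the normal law with mean $0$ and variance $\alpha^2/(2L)$. -/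

import Mathlib

namespace StarNetwork

noncomputable section

open MeasureTheory

/-- The representative in `[0, 1)` of a point of the circle `ℝ / ℤ`. -/
def rep (x : UnitAddCircle) : ℝ := (AddCircle.equivIco (1 : ℝ) 0 x : ℝ)

/-- The function `sin (2 π x)` on the circle. -/
def sinTwoPi (x : UnitAddCircle) : ℝ := Real.sin (2 * Real.pi * rep x)

/-- The four circle contractions: `x / 2 + ω / 4` on `[0, 1/2]` and `(1 - x) / 2 + ω / 4`
on `[1/2, 1]`. -/
def nodeMap (ω : Fin 4) (x : UnitAddCircle) : UnitAddCircle :=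
  if rep x ≤ 1 / 2 then ((rep x / 2 + (ω.val : ℝ) / 4 : ℝ) : UnitAddCircle)
  else (((1 - rep x) / 2 + (ω.val : ℝ) / 4 : ℝ) : UnitAddCircle)

/-- The pairwise coupling `h_ω (x, y) = sin 2πy - sin 2πx - ω / 3.6`. -/
def coupling (ω : Fin 4) (x y : UnitAddCircle) : ℝ :=
  sinTwoPi y - sinTwoPi x - (ω.val : ℝ) / 3.6

/-- Node states of the star: node `0` is the hub, the nodes `j.succ` with `j : Fin L` are the
low-degree nodes. -/
abbrev State (L : ℕ) : Type := Fin (L + 1) → UnitAddCircle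

/-- Noise realizations: one symbol for every time and every node. -/
abbrev Noise (L : ℕ) : Type := ℕ × Fin (L + 1) → Fin 4

/-- One step of the star network dynamics at coupling strength `α`, with noise `w`. -/
def step (L : ℕ) (α : ℝ) (w : Fin (L + 1) → Fin 4) (x : State L) : State L :=
  Fin.cons (α := fun _ => UnitAddCircle)
    (nodeMap (w 0) (x 0) +
      ((α / (L : ℝ) * ∑ j : Fin L, coupling (w 0) (x 0) (x j.succ) : ℝ) : UnitAddCircle))
    (fun j : Fin L => nodeMap (w j.succ) (x j.succ) +
      ((α / (L : ℝ) * coupling (w j.succ) (x j.succ) (x 0) : ℝ) : UnitAddCircle))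

/-- The network trajectory with noise `ω` and initial state `x`. -/
def orbit (L : ℕ) (α : ℝ) (ω : Noise L) (x : State L) : ℕ → State L
  | 0 => x
  | t + 1 => step L α (fun i => ω (t, i)) (orbit L α ω x t)

/-- The mean-field fluctuation `ξ^t`. -/
def fluct (L : ℕ) (α : ℝ) (t : ℕ) (p : Noise L × State L) : ℝ :=
  α / (L : ℝ) * ∑ j : Fin L, sinTwoPi (orbit L α p.1 p.2 t j.succ)

/-- The mean-field reduced map `f_{α, ω}`. -/
def reducedMap (α : ℝ) (ω : Fin 4) (z : UnitAddCircle) : UnitAddCircle :=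
  nodeMap ω z + ((α * ∫ y : UnitAddCircle, coupling ω z y : ℝ) : UnitAddCircle)

/-- The noise symbols are independent and uniform on the four symbols, and independent of the
initial state, which is uniform on the torus. -/
def starProb (L : ℕ) : Measure (Noise L × State L) :=
  (Measure.infinitePi fun _ : ℕ × Fin (L + 1) => (PMF.uniformOfFintype (Fin 4)).toMeasure).prod
    (volume : Measure (State L))

end

end StarNetwork

namespace StarNetwork

noncomputable section

open MeasureTheory ProbabilityTheory Set Filter Topology

/-! Up to its coupling, a low-degree node moves to a point determined by its past plus `ω / 4`, with
`ω` uniform on the four symbols. The sine there takes the values `s, c, -s, -c` with equal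
probability, where `s ^ 2 + c ^ 2 = 1`: its mean is `0` and its variance `1 / 2` wherever the node
was. The coupling moves the node by at most `17 / 6 * (α / L)`. Hence, conditionally on the past,
the fluctuation is within `18 * α ^ 2 / L` of `α / L` times a sum of `L` independent centred
variables bounded by `1` (`abs_meanField_step_sub_le`). At time `0` the uniform initial law,
invariant under quarter turns, gives the same structure without error. No mixing or invariant
measure is needed.

Conditioning is carried out by resampling: overwriting one noise block with a fresh copy preserves
the law and leaves the past trajectory unchanged (`exists_resampling`), so bounds uniform in the
past pass to the full probability.

For such sums Hoeffding's inequality gives the tails. A union bound then yields (ii). For (i), each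
step multiplies the exponential moment of the number of excursions by at most `exp (2 * δ)`, and
Chernoff with Borel–Cantelli concludes. For (iii), Esseen's smoothing inequality gives a
Berry–Esseen bound; frequencies in `[0, 1]` suffice because the unscaled sum has standard deviation
of order `√L`, so its Gaussian limit has density of order `1 / √L`. -/

/-! ### The Fejér kernel: positivity, mass and tails -/

/-- The Fejér kernel, as the cosine transform of the triangle function. -/
def fejerKernel (x : ℝ) : ℝ := ∫ t in (0 : ℝ)..1, (1 - t) * Real.cos (t * x)

lemma continuous_fejerKernel : Continuous fejerKernel := by
  unfold fejerKernel
  exact intervalIntegral.continuous_parametric_intervalIntegral_of_continuous' (by fun_prop) _ _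

lemma fejerKernel_eq {x : ℝ} (hx : x ≠ 0) : fejerKernel x = (1 - Real.cos x) / x ^ 2 := by
  have hd : ∀ t ∈ uIcc (0 : ℝ) 1, HasDerivAt
      (fun t => (1 - t) * (Real.sin (t * x) / x) - Real.cos (t * x) / x ^ 2)
      ((1 - t) * Real.cos (t * x)) t := by
    intro t _
    have h0 : HasDerivAt (fun t : ℝ => t * x) x t := by
      simpa using (hasDerivAt_id t).mul_const x
    have h1 := (h0.sin.div_const x)
    have h2 := (h0.cos.div_const (x ^ 2))
    have h3 : HasDerivAt (fun t : ℝ => 1 - t) (-1) t := by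
      simpa using (hasDerivAt_id t).const_sub 1
    refine ((h3.mul h1).sub h2).congr_deriv ?_
    field_simp
    ring
  rw [fejerKernel, intervalIntegral.integral_eq_sub_of_hasDerivAt hd
    (Continuous.intervalIntegrable (by fun_prop) _ _)]
  simp
  ring

lemma fejerKernel_nonneg (x : ℝ) : 0 ≤ fejerKernel x := by
  rcases eq_or_ne x 0 with rfl | hx
  · unfold fejerKernel
    apply intervalIntegral.integral_nonneg (by norm_num)
    intro t ht
    simp only [mul_zero, Real.cos_zero, mul_one, sub_nonneg]
    exact ht.2
  · rw [fejerKernel_eq hx]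
    have := Real.cos_le_one x
    exact div_nonneg (by linarith) (sq_nonneg x)

lemma fejerKernel_le {x : ℝ} (hx : x ≠ 0) : fejerKernel x ≤ 2 * x ^ (-2 : ℝ) := by
  rw [fejerKernel_eq hx]
  have := Real.neg_one_le_cos x
  have h2 : x ^ (-2 : ℝ) = (x ^ 2)⁻¹ := by
    rw [show (-2 : ℝ) = ((-2 : ℤ) : ℝ) by norm_num, Real.rpow_intCast]
    rfl
  rw [h2, div_eq_mul_inv]
  gcongr
  linarith

lemma fejerKernel_neg (x : ℝ) : fejerKernel (-x) = fejerKernel x := by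
  simp [fejerKernel]

lemma fejerKernel_ge (x : ℝ) : 1 / 2 - x ^ 2 / 24 ≤ fejerKernel x := by
  have h : ∫ t in (0 : ℝ)..1, (1 - t) * (1 - (t * x) ^ 2 / 2) = 1 / 2 - x ^ 2 / 24 := by
    have hd : ∀ t ∈ uIcc (0 : ℝ) 1, HasDerivAt
        (fun t => t - t ^ 2 / 2 - x ^ 2 / 2 * (t ^ 3 / 3 - t ^ 4 / 4))
        ((1 - t) * (1 - (t * x) ^ 2 / 2)) t := by
      intro t _
      have := ((hasDerivAt_id t).sub ((hasDerivAt_pow 2 t).div_const 2)).sub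
        ((((hasDerivAt_pow 3 t).div_const 3).sub ((hasDerivAt_pow 4 t).div_const 4)).const_mul
          (x ^ 2 / 2))
      refine this.congr_deriv ?_
      norm_num
      ring
    rw [intervalIntegral.integral_eq_sub_of_hasDerivAt hd
      (Continuous.intervalIntegrable (by fun_prop) _ _)]
    ring
  rw [← h]
  apply intervalIntegral.integral_mono_on (by norm_num)
    (Continuous.intervalIntegrable (by fun_prop) _ _)
    (Continuous.intervalIntegrable (by fun_prop) _ _)
  intro t ht
  exact mul_le_mul_of_nonneg_left (Real.one_sub_sq_div_two_le_cos) (by linarith [ht.2])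

lemma integrableOn_fejerKernel_Ioi : IntegrableOn fejerKernel (Ioi 4) := by
  refine Integrable.mono' (g := fun x => 2 * x ^ (-2 : ℝ))
    ((integrableOn_Ioi_rpow_of_lt (by norm_num) (by norm_num)).const_mul 2)
    continuous_fejerKernel.aestronglyMeasurable ?_
  filter_upwards [ae_restrict_mem measurableSet_Ioi] with x hx
  rw [Real.norm_of_nonneg (fejerKernel_nonneg x)]
  exact fejerKernel_le (by have : (4 : ℝ) < x := hx; positivity)

lemma setIntegral_fejerKernel_Ioi_le : ∫ x in Ioi 4, fejerKernel x ≤ 1 / 2 := by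
  calc ∫ x in Ioi 4, fejerKernel x ≤ ∫ x in Ioi (4 : ℝ), 2 * x ^ (-2 : ℝ) := by
        refine setIntegral_mono_on integrableOn_fejerKernel_Ioi
          ((integrableOn_Ioi_rpow_of_lt (by norm_num) (by norm_num)).const_mul 2)
          measurableSet_Ioi ?_
        intro x hx
        exact fejerKernel_le (by have : (4 : ℝ) < x := hx; positivity)
    _ = 1 / 2 := by
        rw [integral_const_mul, integral_Ioi_rpow_of_lt (by norm_num) (by norm_num)]
        rw [show (-2 : ℝ) + 1 = ((-1 : ℤ) : ℝ) by norm_num, Real.rpow_intCast]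
        norm_num

lemma integrableOn_fejerKernel_Iic : IntegrableOn fejerKernel (Iic (-4)) := by
  have h := integrableOn_fejerKernel_Ioi
  rw [← integrableOn_Ici_iff_integrableOn_Ioi] at h
  have h2 := h.comp_neg
  simpa [fejerKernel_neg] using h2

lemma setIntegral_fejerKernel_Iic_le : ∫ x in Iic (-4), fejerKernel x ≤ 1 / 2 := by
  have h := integral_comp_neg_Iic (-4 : ℝ) fejerKernel
  simp only [fejerKernel_neg, neg_neg] at h
  rw [h]
  exact setIntegral_fejerKernel_Ioi_le

lemma integrable_fejerKernel : Integrable fejerKernel := by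
  have h : IntegrableOn fejerKernel (Iic (-4) ∪ Ioc (-4) 4 ∪ Ioi 4) :=
    (integrableOn_fejerKernel_Iic.union
      ((continuous_fejerKernel.integrableOn_Icc).mono_set Ioc_subset_Icc_self)).union
      integrableOn_fejerKernel_Ioi
  rw [Iic_union_Ioc_eq_Iic (by norm_num), Iic_union_Ioi] at h
  exact integrableOn_univ.mp h

lemma integral_eq_add_tails {f : ℝ → ℝ} (hf : Integrable f) :
    ∫ x, f x = (∫ x in Iic (-4), f x) + (∫ x in (-4 : ℝ)..4, f x) + ∫ x in Ioi 4, f x := by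
  rw [← intervalIntegral.integral_Iic_sub_Iic hf.integrableOn hf.integrableOn,
    add_sub_cancel, intervalIntegral.integral_Iic_add_Ioi hf.integrableOn hf.integrableOn]

/-- What matters is that `16 / 9` exceeds `1`, the bound for the two tails together: this surplus
later lets a supremum be absorbed. -/
lemma intervalIntegral_fejerKernel_ge : 16 / 9 ≤ ∫ x in (-4 : ℝ)..4, fejerKernel x := by
  have hi : ∀ a b : ℝ, IntervalIntegrable fejerKernel volume a b :=
    fun a b => continuous_fejerKernel.intervalIntegrable _ _
  calc (16 / 9 : ℝ) = ∫ x in (-2 : ℝ)..2, (1 / 2 - x ^ 2 / 24) := by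
        rw [intervalIntegral.integral_sub (by simp)
          (Continuous.intervalIntegrable (by fun_prop) _ _)]
        simp [intervalIntegral.integral_div]
        norm_num
    _ ≤ ∫ x in (-2 : ℝ)..2, fejerKernel x := by
        apply intervalIntegral.integral_mono_on (by norm_num)
          (Continuous.intervalIntegrable (by fun_prop) _ _) (hi _ _)
        intro x _
        exact fejerKernel_ge x
    _ ≤ ∫ x in (-4 : ℝ)..4, fejerKernel x := by
        apply intervalIntegral.integral_mono_interval (by norm_num) (by norm_num) (by norm_num)
          _ (hi _ _)
        exact Eventually.of_forall fejerKernel_nonneg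

lemma intervalIntegral_id_mul_fejerKernel : ∫ x in (-4 : ℝ)..4, x * fejerKernel x = 0 := by
  have h := intervalIntegral.integral_comp_neg (a := -4) (b := 4) (fun x => x * fejerKernel x)
  simp only [fejerKernel_neg, neg_mul, neg_neg, intervalIntegral.integral_neg] at h
  linarith

/-! ### Recovering the uniform distance from Fejér averages -/

/-- A lower bound for a smoothed function that decays at most linearly on the window `[-4, 4]`. -/
lemma window_lower_bound {E : ℝ → ℝ} (hE : Measurable E) {Δ d m σ η : ℝ}
    (hb : ∀ y, |E y| ≤ Δ)
    (hw : ∀ y ∈ Icc (-4 : ℝ) 4, d - m * (4 + σ * y) ≤ E y)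
    (hη : ∫ y, E y * fejerKernel y ≤ η) :
    (d - 4 * m) * (∫ x in (-4 : ℝ)..4, fejerKernel x) ≤ η + Δ := by
  have hΔ : 0 ≤ Δ := (abs_nonneg _).trans (hb 0)
  have hi : Integrable (fun y => E y * fejerKernel y) :=
    integrable_fejerKernel.bdd_mul hE.aestronglyMeasurable (Eventually.of_forall hb)
  have tail : ∀ S : Set ℝ, MeasurableSet S → ∫ x in S, fejerKernel x ≤ 1 / 2 →
      -(Δ / 2) ≤ ∫ x in S, E x * fejerKernel x := by
    intro S hS hS2
    calc -(Δ / 2) ≤ -Δ * ∫ x in S, fejerKernel x := by nlinarith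
      _ = ∫ x in S, -Δ * fejerKernel x := by rw [integral_const_mul]
      _ ≤ _ := by
        refine setIntegral_mono_on (integrable_fejerKernel.const_mul _).integrableOn
          hi.integrableOn hS ?_
        intro x _
        exact mul_le_mul_of_nonneg_right (neg_le_of_abs_le (hb x)) (fejerKernel_nonneg x)
  have t1 := tail _ measurableSet_Iic setIntegral_fejerKernel_Iic_le
  have t2 := tail _ measurableSet_Ioi setIntegral_fejerKernel_Ioi_le
  have hc := continuous_fejerKernel
  have mid : (d - 4 * m) * (∫ x in (-4 : ℝ)..4, fejerKernel x) ≤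
      ∫ x in (-4 : ℝ)..4, E x * fejerKernel x := by
    calc (d - 4 * m) * (∫ x in (-4 : ℝ)..4, fejerKernel x)
        -- The kernel is even, so the term linear in `x` integrates to zero.
        = ∫ x in (-4 : ℝ)..4, (d - m * (4 + σ * x)) * fejerKernel x := by
          have : ∀ x, (d - m * (4 + σ * x)) * fejerKernel x =
            (d - 4 * m) * fejerKernel x - (m * σ) * (x * fejerKernel x) := fun x => by ring
          simp_rw [this]
          rw [intervalIntegral.integral_sub (Continuous.intervalIntegrable (by fun_prop) _ _)
            (Continuous.intervalIntegrable (by fun_prop) _ _),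
            intervalIntegral.integral_const_mul, intervalIntegral.integral_const_mul,
            intervalIntegral_id_mul_fejerKernel]
          ring
      _ ≤ _ := by
        apply intervalIntegral.integral_mono_on (by norm_num)
          (Continuous.intervalIntegrable (by fun_prop) _ _) hi.intervalIntegrable
        intro x hx
        exact mul_le_mul_of_nonneg_right (hw x hx) (fejerKernel_nonneg x)
  rw [integral_eq_add_tails hi] at hη
  linarith

/-- If the Fejér averages of the difference of two distribution functions are at most `η` and one
of them is `m`-Lipschitz, then the difference is uniformly small. -/
lemma abs_cdf_sub_le_of_smoothed (μ ν : Measure ℝ) {m η : ℝ}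
    (hm : ∀ x y, x ≤ y → cdf ν y - cdf ν x ≤ m * (y - x))
    (hη : ∀ w, |∫ y, (cdf μ (w - y) - cdf ν (w - y)) * fejerKernel y| ≤ η) (x : ℝ) :
    |cdf μ x - cdf ν x| ≤ 64 / 7 * m + 9 / 7 * η := by
  set D : ℝ → ℝ := fun x => cdf μ x - cdf ν x with hD
  have hDm : Measurable D := (monotone_cdf μ).measurable.sub (monotone_cdf ν).measurable
  have hD1 : ∀ x, |D x| ≤ 1 := fun x => by
    have := cdf_nonneg μ x
    have := cdf_nonneg ν x
    have := cdf_le_one μ x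
    have := cdf_le_one ν x
    rw [abs_le]; constructor <;> simp only [hD] <;> linarith
  have hbdd : BddAbove (range fun x => |D x|) := ⟨1, by rintro _ ⟨x, rfl⟩; exact hD1 x⟩
  set Δ : ℝ := ⨆ x, |D x| with hΔ
  have hle : ∀ x, |D x| ≤ Δ := fun x => le_ciSup hbdd x
  have hη0 : 0 ≤ η := (abs_nonneg _).trans (hη 0)
  have hm0 : 0 ≤ m := by
    have h1 := hm 0 1 (by norm_num)
    have h2 := monotone_cdf ν (show (0 : ℝ) ≤ 1 by norm_num)
    linarith
  have hΔ0 : 0 ≤ Δ := (abs_nonneg _).trans (hle 0)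
  have hA := intervalIntegral_fejerKernel_ge
  set A := ∫ x in (-4 : ℝ)..4, fejerKernel x
  have key : ∀ d, (d - 4 * m) * A ≤ η + Δ → d ≤ 4 * m + 9 / 16 * (η + Δ) := by
    intro d hd
    by_cases h : d - 4 * m ≤ 0
    · linarith
    · push Not at h
      nlinarith
  -- Recentring at `x + 4` or `x - 4` puts the whole window on one side of `x`. There monotonicity
  -- of `cdf μ` and the Lipschitz bound on `cdf ν` keep the difference from shrinking faster than
  -- linearly.
  have hpt : ∀ x, |D x| ≤ 4 * m + 9 / 16 * (η + Δ) := by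
    intro x
    rw [abs_le']
    constructor
    · apply key
      refine window_lower_bound (E := fun y => D (x + 4 - y)) (σ := -1)
        (hDm.comp (by fun_prop)) (fun y => hle _) ?_ ((le_abs_self _).trans (hη (x + 4)))
      intro y hy
      have h1 := monotone_cdf μ (show x ≤ x + 4 - y by linarith [hy.2])
      have h2 := hm x (x + 4 - y) (by linarith [hy.2])
      simp only [hD]
      linarith
    · apply key
      refine window_lower_bound (E := fun y => -D (x - 4 - y)) (σ := 1)
        (hDm.comp (by fun_prop)).neg (fun y => by rw [abs_neg]; exact hle _) ?_ ?_
      · intro y hy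
        have h1 := monotone_cdf μ (show x - 4 - y ≤ x by linarith [hy.1])
        have h2 := hm (x - 4 - y) x (by linarith [hy.1])
        simp only [hD]
        linarith
      · simp_rw [neg_mul]
        rw [integral_neg]
        exact (neg_le_abs _).trans (hη (x - 4))
  -- The supremum reappears on the right with coefficient `9 / 16 < 1`; solving for it produces `64
  -- / 7` and `9 / 7`.
  have hsup : Δ ≤ 4 * m + 9 / 16 * (η + Δ) := ciSup_le hpt
  have := hle x
  linarith

/-! ### Fourier side: Esseen's smoothing inequality -/

/-- The integral of a cosine of frequency `t` over a window of length `M` ending at `v`. -/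
def cosWindow (M t v : ℝ) : ℝ := ∫ r in (0 : ℝ)..M, Real.cos (t * (v - r))

lemma continuous_cosWindow (M : ℝ) : Continuous fun p : ℝ × ℝ => cosWindow M p.1 p.2 := by
  unfold cosWindow
  exact intervalIntegral.continuous_parametric_intervalIntegral_of_continuous' (by fun_prop) _ _

lemma abs_cosWindow_le (M t v : ℝ) : |cosWindow M t v| ≤ |M| := by
  have h := intervalIntegral.norm_integral_le_of_norm_le_const (a := 0) (b := M) (C := 1)
    (f := fun r => Real.cos (t * (v - r))) (fun r _ => Real.abs_cos_le_one _)
  simpa [cosWindow] using h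

lemma cosWindow_eq {t : ℝ} (ht : t ≠ 0) (M v : ℝ) :
    cosWindow M t v = (Real.sin (t * v) - Real.sin (t * (v - M))) / t := by
  have hd : ∀ r ∈ uIcc (0 : ℝ) M, HasDerivAt (fun r => -Real.sin (t * (v - r)) / t)
      (Real.cos (t * (v - r))) r := by
    intro r _
    have h0 : HasDerivAt (fun r : ℝ => t * (v - r)) (-t) r := by
      simpa using ((hasDerivAt_id r).const_sub v).const_mul t
    refine (h0.sin.neg.div_const t).congr_deriv ?_
    field_simp
  rw [cosWindow, intervalIntegral.integral_eq_sub_of_hasDerivAt hd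
    (Continuous.intervalIntegrable (by fun_prop) _ _)]
  simp only [sub_zero]
  ring

lemma integral_fejerKernel_window (M v : ℝ) :
    ∫ r in (0 : ℝ)..M, fejerKernel (v - r) = ∫ t in (0 : ℝ)..1, (1 - t) * cosWindow M t v := by
  unfold fejerKernel cosWindow
  rw [intervalIntegral_intervalIntegral_swap]
  · simp_rw [intervalIntegral.integral_const_mul]
  · refine (ContinuousOn.integrableOn_compact (K := uIcc 0 M ×ˢ uIcc 0 1)
      (isCompact_uIcc.prod isCompact_uIcc) (Continuous.continuousOn (by fun_prop))).mono_set
      (prod_mono uIoc_subset_uIcc uIoc_subset_uIcc)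

/-- Fubini for the strip `w - y - M < s ≤ w - y`. A finite length `M` is kept because the cosine
integral over a half-line diverges; `M` tends to infinity only after the bound is proved. -/
lemma integral_cdf_window_mul_fejerKernel (μ : Measure ℝ) [IsProbabilityMeasure μ] {M : ℝ}
    (hM : 0 ≤ M) (w : ℝ) :
    ∫ y, (cdf μ (w - y) - cdf μ (w - y - M)) * fejerKernel y =
      ∫ s, (∫ r in (0 : ℝ)..M, fejerKernel (w - s - r)) ∂μ := by
  set S : Set (ℝ × ℝ) := {p | w - p.1 - M < p.2 ∧ p.2 ≤ w - p.1} with hS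
  have hSm : MeasurableSet S := by
    have h1 : MeasurableSet {p : ℝ × ℝ | w - p.1 - M < p.2} :=
      measurableSet_lt (by fun_prop) (by fun_prop)
    have h2 : MeasurableSet {p : ℝ × ℝ | p.2 ≤ w - p.1} :=
      measurableSet_le (by fun_prop) (by fun_prop)
    exact h1.inter h2
  have hint : Integrable (Function.uncurry fun y s => S.indicator (fun p => fejerKernel p.1) (y, s))
      ((volume : Measure ℝ).prod μ) := by
    have : Integrable (fun p : ℝ × ℝ => fejerKernel p.1) ((volume : Measure ℝ).prod μ) :=
      integrable_fejerKernel.comp_fst μ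
    exact this.indicator hSm
  have hswap := integral_integral_swap hint
  have h1 : ∀ y, ∫ s, S.indicator (fun p => fejerKernel p.1) (y, s) ∂μ =
      (cdf μ (w - y) - cdf μ (w - y - M)) * fejerKernel y := by
    intro y
    have : (fun s => S.indicator (fun p => fejerKernel p.1) (y, s)) =
        (Ioc (w - y - M) (w - y)).indicator fun _ => fejerKernel y := by
      ext s
      simp [indicator, hS]
    rw [this, integral_indicator measurableSet_Ioc, setIntegral_const, smul_eq_mul,
      cdf_eq_real, cdf_eq_real, ← measureReal_sdiff (Iic_subset_Iic.2 (by linarith))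
        measurableSet_Iic, Iic_sdiff_Iic]
  have h2 : ∀ s, ∫ y, S.indicator (fun p => fejerKernel p.1) (y, s) =
      ∫ r in (0 : ℝ)..M, fejerKernel (w - s - r) := by
    intro s
    have : (fun y => S.indicator (fun p => fejerKernel p.1) (y, s)) =
        (Ioc (w - s - M) (w - s)).indicator fejerKernel := by
      ext y
      have : (w - y - M < s ∧ s ≤ w - y) ↔ (w - s - M < y ∧ y ≤ w - s) := by
        constructor <;> rintro ⟨h, h'⟩ <;> constructor <;> linarith
      simp [indicator, hS, this]
    rw [this, integral_indicator measurableSet_Ioc,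
      ← intervalIntegral.integral_of_le (by linarith),
      intervalIntegral.integral_comp_sub_left, sub_zero]
  simp_rw [h1, h2] at hswap
  exact hswap

lemma integral_cosWindow_swap (μ : Measure ℝ) [IsProbabilityMeasure μ] (M w : ℝ) :
    ∫ s, (∫ t in (0 : ℝ)..1, (1 - t) * cosWindow M t (w - s)) ∂μ =
      ∫ t in (0 : ℝ)..1, (1 - t) * ∫ s, cosWindow M t (w - s) ∂μ := by
  have hc := continuous_cosWindow M
  have hc2 : Continuous fun p : ℝ × ℝ => cosWindow M p.1 (w - p.2) :=
    hc.comp (by fun_prop : Continuous fun p : ℝ × ℝ => (p.1, w - p.2))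
  rw [← intervalIntegral_integral_swap]
  · simp_rw [integral_const_mul]
  · have : IsFiniteMeasure ((volume : Measure ℝ).restrict (uIoc (0 : ℝ) 1)) := by
      rw [uIoc_of_le zero_le_one]
      infer_instance
    refine Integrable.mono' (integrable_const |M|) ?_ ?_
    · exact (Continuous.mul (by fun_prop) hc2).aestronglyMeasurable
    · have h0 : ∀ᵐ t ∂(volume.restrict (uIoc (0 : ℝ) 1)), t ∈ uIoc (0 : ℝ) 1 :=
        ae_restrict_mem measurableSet_uIoc
      have := Measure.quasiMeasurePreserving_fst (μ := volume.restrict (uIoc (0 : ℝ) 1)) (ν := μ)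
      filter_upwards [this.ae h0] with p hp
      rw [uIoc_of_le zero_le_one] at hp
      simp only [Function.uncurry, Real.norm_eq_abs, abs_mul]
      have h1 : |1 - p.1| ≤ 1 := by rw [abs_le]; constructor <;> linarith [hp.1, hp.2]
      calc |1 - p.1| * |cosWindow M p.1 (w - p.2)| ≤ 1 * |M| :=
            mul_le_mul h1 (abs_cosWindow_le _ _ _) (abs_nonneg _) zero_le_one
        _ = |M| := one_mul _

lemma integral_sin_eq_im_charFun (μ : Measure ℝ) [IsProbabilityMeasure μ] (t w : ℝ) :
    ∫ s, Real.sin (t * (w - s)) ∂μ =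
      (Complex.exp (t * w * Complex.I) * charFun μ (-t)).im := by
  rw [charFun_apply_real, ← integral_const_mul]
  have hi : Integrable (fun s : ℝ => Complex.exp (t * w * Complex.I) *
      Complex.exp (((-t : ℝ) : ℂ) * s * Complex.I)) μ := by
    refine Integrable.mono' (integrable_const 1)
      (Continuous.aestronglyMeasurable (by fun_prop)) (Eventually.of_forall fun s => ?_)
    rw [← Complex.exp_add, ← add_mul]
    norm_cast
    rw [Complex.norm_exp_ofReal_mul_I]
  have := Complex.imCLM.integral_comp_comm hi
  simp only [Complex.imCLM_apply] at this
  rw [← this]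
  congr 1
  ext s
  rw [← Complex.exp_add, ← add_mul]
  norm_cast
  rw [Complex.exp_ofReal_mul_I_im]
  congr 1
  ring

lemma abs_integral_sin_sub_le (μ ν : Measure ℝ) [IsProbabilityMeasure μ]
    [IsProbabilityMeasure ν] (t w : ℝ) :
    |∫ s, Real.sin (t * (w - s)) ∂μ - ∫ s, Real.sin (t * (w - s)) ∂ν| ≤
      ‖charFun μ t - charFun ν t‖ := by
  rw [integral_sin_eq_im_charFun, integral_sin_eq_im_charFun, ← Complex.sub_im, ← mul_sub]
  refine (Complex.abs_im_le_norm _).trans ?_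
  rw [norm_mul, charFun_neg, charFun_neg, ← map_sub, RCLike.norm_conj]
  norm_cast
  rw [Complex.norm_exp_ofReal_mul_I, one_mul]

lemma integral_cosWindow (μ : Measure ℝ) [IsProbabilityMeasure μ] {t : ℝ} (ht : t ≠ 0)
    (M w : ℝ) :
    ∫ s, cosWindow M t (w - s) ∂μ =
      (∫ s, Real.sin (t * (w - s)) ∂μ - ∫ s, Real.sin (t * (w - M - s)) ∂μ) / t := by
  have hi : ∀ w, Integrable (fun s => Real.sin (t * (w - s))) μ := fun w =>
    Integrable.mono' (integrable_const 1) (Continuous.aestronglyMeasurable (by fun_prop))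
      (Eventually.of_forall fun s => Real.abs_sin_le_one _)
  simp_rw [cosWindow_eq ht]
  rw [integral_div, integral_sub (hi w)]
  · congr 2
    congr 1
    ext s
    ring_nf
  · convert hi (w - M) using 3
    ring

/-- Integrating the cosine costs a factor `1 / t`, which the factor `t` in `hb` cancels. The two
ends of the window account for the `2`, and the bound is uniform in `M`. -/
lemma abs_window_smoothed_sub_le (μ ν : Measure ℝ) [IsProbabilityMeasure μ]
    [IsProbabilityMeasure ν] {b : ℝ → ℝ} (hbi : IntervalIntegrable b volume 0 1)
    (hb : ∀ t ∈ Ioc (0 : ℝ) 1, ‖charFun μ t - charFun ν t‖ ≤ t * b t) {M : ℝ} (hM : 0 ≤ M)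
    (w : ℝ) :
    |(∫ y, (cdf μ (w - y) - cdf μ (w - y - M)) * fejerKernel y) -
      ∫ y, (cdf ν (w - y) - cdf ν (w - y - M)) * fejerKernel y| ≤
      2 * ∫ t in (0 : ℝ)..1, b t := by
  rw [integral_cdf_window_mul_fejerKernel μ hM, integral_cdf_window_mul_fejerKernel ν hM]
  simp_rw [integral_fejerKernel_window]
  rw [integral_cosWindow_swap, integral_cosWindow_swap]
  have hcont : ∀ ρ : Measure ℝ, IsProbabilityMeasure ρ →
      IntervalIntegrable (fun t => (1 - t) * ∫ s, cosWindow M t (w - s) ∂ρ) volume 0 1 := by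
    intro ρ hρ
    have hc : Continuous fun t => ∫ s, cosWindow M t (w - s) ∂ρ := by
      refine continuous_of_dominated (bound := fun _ => |M|) ?_ ?_ (integrable_const _) ?_
      · intro t
        exact ((continuous_cosWindow M).comp
          (by fun_prop : Continuous fun s : ℝ => (t, w - s))).aestronglyMeasurable
      · exact fun t => Eventually.of_forall fun s => abs_cosWindow_le _ _ _
      · exact Eventually.of_forall fun s => (continuous_cosWindow M).comp
          (by fun_prop : Continuous fun t : ℝ => (t, w - s))
    exact Continuous.intervalIntegrable (by fun_prop) _ _
  rw [← intervalIntegral.integral_sub (hcont μ inferInstance) (hcont ν inferInstance),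
    ← intervalIntegral.integral_const_mul, ← Real.norm_eq_abs]
  refine intervalIntegral.norm_integral_le_of_norm_le zero_le_one ?_ (hbi.const_mul 2)
  refine Eventually.of_forall fun t ht => ?_
  have ht0 : 0 < t := ht.1
  rw [integral_cosWindow μ ht0.ne', integral_cosWindow ν ht0.ne', ← mul_sub, ← sub_div,
    Real.norm_eq_abs, abs_mul, abs_div, abs_of_pos ht0]
  have h1 : |1 - t| ≤ 1 := by rw [abs_le]; constructor <;> linarith [ht.2]
  have h2 := abs_integral_sin_sub_le μ ν t w
  have h3 := abs_integral_sin_sub_le μ ν t (w - M)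
  have h4 := hb t ht
  set a1 := ∫ s, Real.sin (t * (w - s)) ∂μ
  set a2 := ∫ s, Real.sin (t * (w - s)) ∂ν
  set a3 := ∫ s, Real.sin (t * (w - M - s)) ∂μ
  set a4 := ∫ s, Real.sin (t * (w - M - s)) ∂ν
  have h5 : |a1 - a3 - (a2 - a4)| ≤ 2 * (t * b t) := by
    have := abs_sub (a1 - a2) (a3 - a4)
    rw [show a1 - a3 - (a2 - a4) = (a1 - a2) - (a3 - a4) by ring]
    linarith
  calc |1 - t| * (|a1 - a3 - (a2 - a4)| / t) ≤ 1 * (2 * (t * b t) / t) := by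
        gcongr
    _ = 2 * b t := by field_simp

lemma tendsto_integral_cdf_window (μ : Measure ℝ) (w : ℝ) :
    Tendsto (fun M : ℕ => ∫ y, (cdf μ (w - y) - cdf μ (w - y - M)) * fejerKernel y) atTop
      (𝓝 (∫ y, cdf μ (w - y) * fejerKernel y)) := by
  have hm : Measurable (cdf μ) := (monotone_cdf μ).measurable
  refine tendsto_integral_of_dominated_convergence fejerKernel ?_ integrable_fejerKernel ?_ ?_
  · intro M
    have := continuous_fejerKernel.measurable
    exact (((hm.comp (by fun_prop)).sub (hm.comp (by fun_prop))).mul this).aestronglyMeasurable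
  · intro M
    refine Eventually.of_forall fun y => ?_
    rw [Real.norm_eq_abs, abs_mul, abs_of_nonneg (fejerKernel_nonneg y)]
    have h1 := cdf_nonneg μ (w - y - M)
    have h2 := cdf_le_one μ (w - y)
    have h3 := monotone_cdf μ (show w - y - M ≤ w - y by simp)
    have : |cdf μ (w - y) - cdf μ (w - y - M)| ≤ 1 := by rw [abs_le]; constructor <;> linarith
    exact mul_le_of_le_one_left (fejerKernel_nonneg y) this
  · refine Eventually.of_forall fun y => ?_
    have h : Tendsto (fun M : ℕ => w - y - (M : ℝ)) atTop atBot := by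
      simp_rw [sub_eq_add_neg (w - y)]
      exact tendsto_atBot_add_const_left _ _ (tendsto_neg_atTop_atBot.comp
        tendsto_natCast_atTop_atTop)
    have := ((tendsto_cdf_atBot μ).comp h).const_sub (cdf μ (w - y))
    simpa using this.mul_const (fejerKernel y)

/-- **Esseen's smoothing inequality** (on the frequency window `[0, 1]`). -/
theorem abs_cdf_sub_le_of_charFun (μ ν : Measure ℝ) [IsProbabilityMeasure μ]
    [IsProbabilityMeasure ν] {b : ℝ → ℝ} (hbi : IntervalIntegrable b volume 0 1)
    (hb : ∀ t ∈ Ioc (0 : ℝ) 1, ‖charFun μ t - charFun ν t‖ ≤ t * b t) {m : ℝ}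
    (hm : ∀ x y, x ≤ y → cdf ν y - cdf ν x ≤ m * (y - x)) (x : ℝ) :
    |cdf μ x - cdf ν x| ≤ 64 / 7 * m + 18 / 7 * ∫ t in (0 : ℝ)..1, b t := by
  have hη : ∀ w, |∫ y, (cdf μ (w - y) - cdf ν (w - y)) * fejerKernel y| ≤
      2 * ∫ t in (0 : ℝ)..1, b t := by
    intro w
    have hi : ∀ ρ : Measure ℝ, Integrable fun y => cdf ρ (w - y) * fejerKernel y := by
      intro ρ
      refine integrable_fejerKernel.bdd_mul (c := 1)
        ((monotone_cdf ρ).measurable.comp (by fun_prop)).aestronglyMeasurable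
        (Eventually.of_forall fun y => ?_)
      rw [Real.norm_of_nonneg (cdf_nonneg _ _)]
      exact cdf_le_one _ _
    simp_rw [sub_mul]
    rw [integral_sub (hi μ) (hi ν)]
    refine le_of_tendsto
      ((tendsto_integral_cdf_window μ w).sub (tendsto_integral_cdf_window ν w)).abs
      (Eventually.of_forall fun M => ?_)
    exact abs_window_smoothed_sub_le μ ν hbi hb (Nat.cast_nonneg M) w
  have := abs_cdf_sub_le_of_smoothed μ ν hm hη x
  linarith

/-! ### Sums over random quarter translates: Hoeffding and Berry–Esseen -/

/-- The uniform law of one noise symbol. -/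
abbrev symbolLaw : Measure (Fin 4) := (PMF.uniformOfFintype (Fin 4)).toMeasure

/-- The law of the noise symbols of all nodes at one time. -/
abbrev noiseLaw (L : ℕ) : Measure (Fin (L + 1) → Fin 4) := Measure.pi fun _ => symbolLaw

/-- The mean-field sum of low-degree nodes sitting at the quarter translates of `y`. -/
def quarterSum {L : ℕ} (y : Fin L → ℝ) (w : Fin (L + 1) → Fin 4) : ℝ :=
  ∑ j : Fin L, Real.sin (2 * Real.pi * (y j + ((w j.succ).val : ℝ) / 4))

lemma integral_symbolLaw {𝕜 : Type*} [RCLike 𝕜] (f : Fin 4 → 𝕜) :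
    ∫ i, f i ∂symbolLaw = (∑ i, f i) / 4 := by
  rw [PMF.integral_eq_sum]
  have h4 : (algebraMap ℝ 𝕜) 4 = 4 := map_ofNat _ 4
  simp [PMF.uniformOfFintype_apply, RCLike.real_smul_eq_coe_mul, div_eq_inv_mul,
    Finset.mul_sum, h4]

lemma integral_prod_noiseLaw {𝕜 : Type*} [RCLike 𝕜] {L : ℕ} (g : Fin L → Fin 4 → 𝕜) :
    ∫ w, ∏ j, g j (w j.succ) ∂(noiseLaw L) = ∏ j, (∑ i, g j i) / 4 := by
  -- The hub's symbol does not enter the product, so its factor is taken to be `1`.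
  have h := integral_fintype_prod_eq_prod (μ := fun _ : Fin (L + 1) => symbolLaw)
    (Fin.cons (α := fun _ => Fin 4 → 𝕜) (fun _ => 1) g)
  simp only [Fin.prod_univ_succ, Fin.cons_zero, Fin.cons_succ, one_mul] at h
  rw [h]
  simp_rw [integral_symbolLaw]
  simp

/-- Quarter turns permute sine and cosine up to sign. A general `F` serves both exponential moments
and characteristic functions. -/
lemma sin_quarter_sum {E : Type*} [AddCommMonoid E] (F : ℝ → E) (y : ℝ) :
    ∑ i : Fin 4, F (Real.sin (2 * Real.pi * (y + (i.val : ℝ) / 4))) =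
      F (Real.sin (2 * Real.pi * y)) + F (Real.cos (2 * Real.pi * y)) +
        F (-Real.sin (2 * Real.pi * y)) + F (-Real.cos (2 * Real.pi * y)) := by
  have h1 : Real.sin (2 * Real.pi * (y + 1 / 4)) = Real.cos (2 * Real.pi * y) := by
    rw [← Real.sin_add_pi_div_two]; congr 1; ring
  have h2 : Real.sin (2 * Real.pi * (y + 1 / 2)) = -Real.sin (2 * Real.pi * y) := by
    rw [← Real.sin_add_pi]; congr 1; ring
  have h3 : Real.sin (2 * Real.pi * (y + 3 / 4)) = -Real.cos (2 * Real.pi * y) := by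
    rw [← Real.sin_add_pi_div_two, ← Real.sin_add_pi]; congr 1; ring
  rw [Fin.sum_univ_four]
  norm_num [h1, h2, h3]

lemma measurable_quarterSum {L : ℕ} (y : Fin L → ℝ) : Measurable (quarterSum y) :=
  measurable_of_countable _

lemma charFun_map_quarterSum {L : ℕ} (y : Fin L → ℝ) (t : ℝ) :
    charFun ((noiseLaw L).map (quarterSum y)) t =
      ((∏ j, (Real.cos (t * Real.sin (2 * Real.pi * y j)) +
        Real.cos (t * Real.cos (2 * Real.pi * y j))) / 2 : ℝ) : ℂ) := by
  rw [charFun_apply_real, integral_map (measurable_quarterSum y).aemeasurable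
    (Continuous.aestronglyMeasurable (by fun_prop))]
  have h : ∀ w, Complex.exp (t * (quarterSum y w : ℝ) * Complex.I) = ∏ j : Fin L,
      Complex.exp (t * (Real.sin (2 * Real.pi * (y j + ((w j.succ).val : ℝ) / 4)) : ℝ) *
        Complex.I) := by
    intro w
    rw [← Complex.exp_sum, quarterSum]
    push_cast
    rw [Finset.mul_sum, Finset.sum_mul]
  simp_rw [h]
  rw [integral_prod_noiseLaw (fun j i =>
    Complex.exp (t * (Real.sin (2 * Real.pi * (y j + ((i : Fin 4).val : ℝ) / 4)) : ℝ) *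
        Complex.I)), Complex.ofReal_prod]
  refine Finset.prod_congr rfl fun j _ => ?_
  rw [sin_quarter_sum (fun x : ℝ => Complex.exp (t * (x : ℂ) * Complex.I))]
  set s := Real.sin (2 * Real.pi * y j)
  set c := Real.cos (2 * Real.pi * y j)
  push_cast
  rw [Complex.cos, Complex.cos]
  simp only [mul_neg, neg_mul]
  ring

/-- Opposite values pair into hyperbolic cosines, and `cosh u ≤ exp (u ^ 2 / 2)`. -/
lemma integral_exp_mul_quarterSum_le {L : ℕ} (y : Fin L → ℝ) (l : ℝ) :
    ∫ w, Real.exp (l * quarterSum y w) ∂(noiseLaw L) ≤ Real.exp (L * (l ^ 2 / 2)) := by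
  have h : ∀ w, Real.exp (l * quarterSum y w) = ∏ j : Fin L,
      Real.exp (l * Real.sin (2 * Real.pi * (y j + ((w j.succ).val : ℝ) / 4))) := by
    intro w
    rw [← Real.exp_sum, quarterSum, Finset.mul_sum]
  simp_rw [h]
  rw [integral_prod_noiseLaw (fun j i =>
    Real.exp (l * Real.sin (2 * Real.pi * (y j + ((i : Fin 4).val : ℝ) / 4))))]
  calc _ ≤ ∏ j : Fin L, Real.exp (l ^ 2 / 2) := by
        refine Finset.prod_le_prod (fun j _ => by positivity) fun j _ => ?_
        rw [sin_quarter_sum (fun x : ℝ => Real.exp (l * x))]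
        have key : ∀ s : ℝ, s ^ 2 ≤ 1 → Real.exp (l * s) + Real.exp (l * -s) ≤
            2 * Real.exp (l ^ 2 / 2) := by
          intro s hs
          have h1 := Real.cosh_le_exp_half_sq (l * s)
          have h2 : Real.exp ((l * s) ^ 2 / 2) ≤ Real.exp (l ^ 2 / 2) := by
            apply Real.exp_le_exp.2
            nlinarith [sq_nonneg l]
          rw [Real.cosh_eq] at h1
          rw [mul_neg]
          linarith
        have h1 := key _ (Real.sin_sq_le_one (2 * Real.pi * y j))
        have h2 := key _ (Real.cos_sq_le_one (2 * Real.pi * y j))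
        linarith
    _ = _ := by simp [← Real.exp_nat_mul]

lemma integrable_noiseLaw {L : ℕ} (f : (Fin (L + 1) → Fin 4) → ℝ) :
    Integrable f (noiseLaw L) := Integrable.of_finite

/-- Hoeffding's inequality for the mean-field sum. -/
lemma noiseLaw_abs_quarterSum_gt_le {L : ℕ} (hL : 0 < L) (y : Fin L → ℝ) {r : ℝ} (hr : 0 ≤ r) :
    (noiseLaw L).real {w | r < |quarterSum y w|} ≤ 2 * Real.exp (-(r ^ 2 / (2 * L))) := by
  have hL' : (0 : ℝ) < L := by exact_mod_cast hL
  have key : ∀ σ : ℝ, σ ^ 2 = 1 → (noiseLaw L).real {w | r ≤ σ * quarterSum y w} ≤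
      Real.exp (-(r ^ 2 / (2 * L))) := by
    intro σ hσ
    -- The parameter `r / L` minimises `-t * r + L * t ^ 2 / 2`.
    have h1 := measure_ge_le_exp_mul_mgf (μ := noiseLaw L) (X := fun w => σ * quarterSum y w)
      (t := r / L) r (by positivity) (integrable_noiseLaw _)
    refine h1.trans ?_
    have h2 := integral_exp_mul_quarterSum_le y (r / L * σ)
    rw [mgf]
    simp_rw [← mul_assoc]
    refine (mul_le_mul_of_nonneg_left h2 (Real.exp_pos _).le).trans ?_
    rw [← Real.exp_add]
    apply le_of_eq
    congr 1
    rw [mul_pow, hσ]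
    field_simp
    ring
  calc (noiseLaw L).real {w | r < |quarterSum y w|}
      ≤ (noiseLaw L).real ({w | r ≤ 1 * quarterSum y w} ∪ {w | r ≤ -1 * quarterSum y w}) := by
        refine measureReal_mono ?_
        intro w hw
        rcases lt_abs.1 (mem_ofPred_eq ▸ hw) with h | h
        · left; simpa using h.le
        · right; simpa using h.le
    _ ≤ _ := measureReal_union_le _ _
    _ ≤ _ := by linarith [key 1 (by norm_num), key (-1) (by norm_num)]

/-- Telescoping, one factor exchanged at a time. The extra factor `q` on the left avoids the
exponent `S.card - 1`. -/
lemma mul_abs_prod_sub_pow_le {ι : Type*} (S : Finset ι) (a : ι → ℝ) {b q d : ℝ}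
    (ha : ∀ i, |a i| ≤ q) (hb : |b| ≤ q) (hd : ∀ i, |a i - b| ≤ d) :
    q * |∏ i ∈ S, a i - b ^ S.card| ≤ S.card * d * q ^ S.card := by
  classical
  have hq : 0 ≤ q := (abs_nonneg b).trans hb
  induction S using Finset.induction_on with
  | empty => simp
  | insert i S hi ih =>
    rw [Finset.prod_insert hi, Finset.card_insert_of_notMem hi]
    have hd0 : 0 ≤ d := (abs_nonneg _).trans (hd i)
    have hp : |b ^ S.card| ≤ q ^ S.card := by
      rw [abs_pow]; exact pow_le_pow_left₀ (abs_nonneg _) hb _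
    have h1 : |a i * ∏ j ∈ S, a j - b ^ (S.card + 1)| ≤
        |a i| * |∏ j ∈ S, a j - b ^ S.card| + |a i - b| * |b ^ S.card| := by
      rw [← abs_mul, ← abs_mul]
      refine (abs_add_le _ _).trans' (le_of_eq ?_)
      congr 1
      ring
    calc q * |a i * ∏ j ∈ S, a j - b ^ (S.card + 1)|
        ≤ q * (|a i| * |∏ j ∈ S, a j - b ^ S.card| + |a i - b| * |b ^ S.card|) := by gcongr
      _ = |a i| * (q * |∏ j ∈ S, a j - b ^ S.card|) + q * (|a i - b| * |b ^ S.card|) := by ring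
      _ ≤ q * (S.card * d * q ^ S.card) + q * (d * q ^ S.card) := by
          gcongr
          · exact ha i
          · exact hd i
      _ = _ := by push_cast; ring

/-- Since `s ^ 2 + c ^ 2 = 1`, the quadratic Taylor term is `t ^ 2 / 4` independently of the
position, which matches the Gaussian. Weakening the rate to `1 / 5` leaves room for the quartic
remainder. -/
lemma symbol_charFun_bounds {t s c : ℝ} (ht : t ∈ Ioc (0 : ℝ) 1) (hsc : s ^ 2 + c ^ 2 = 1) :
    |(Real.cos (t * s) + Real.cos (t * c)) / 2 - Real.exp (-(t ^ 2 / 4))| ≤ t ^ 4 / 16 ∧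
      |(Real.cos (t * s) + Real.cos (t * c)) / 2| ≤ Real.exp (-(t ^ 2 / 5)) := by
  have ht0 := ht.1
  have ht1 := ht.2
  have ht2 : t ^ 2 ≤ 1 := by nlinarith
  have hs1 : s ^ 2 ≤ 1 := by nlinarith [sq_nonneg c]
  have hc1 : c ^ 2 ≤ 1 := by nlinarith [sq_nonneg s]
  have key : ∀ u : ℝ, u ^ 2 ≤ 1 →
      |Real.cos (t * u) - (1 - t ^ 2 * u ^ 2 / 2)| ≤ t ^ 4 * u ^ 2 * (5 / 96) := by
    intro u hu
    have h1 : |t * u| ≤ 1 := by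
      rw [abs_le_one_iff_mul_self_le_one]
      nlinarith [mul_le_mul ht2 hu (sq_nonneg u) zero_le_one]
    have h2 := Real.cos_bound h1
    have h3 : |t * u| ^ 4 = t ^ 4 * u ^ 2 * u ^ 2 := by
      rw [show |t * u| ^ 4 = (|t * u| ^ 2) ^ 2 by ring, sq_abs]; ring
    rw [h3, mul_pow] at h2
    refine h2.trans ?_
    have : t ^ 4 * u ^ 2 * u ^ 2 ≤ t ^ 4 * u ^ 2 * 1 := by gcongr
    linarith
  have k1 := abs_le.1 (key s hs1)
  have k2 := abs_le.1 (key c hc1)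
  have e1 : t ^ 4 * s ^ 2 + t ^ 4 * c ^ 2 = t ^ 4 := by rw [← mul_add, hsc, mul_one]
  have e2 : t ^ 2 * s ^ 2 + t ^ 2 * c ^ 2 = t ^ 2 := by rw [← mul_add, hsc, mul_one]
  have t4 : t ^ 4 ≤ t ^ 2 := by nlinarith [sq_nonneg t]
  have t40 : 0 ≤ t ^ 4 := by positivity
  have x1 := Real.add_one_le_exp (-(t ^ 2 / 4))
  have x2 := Real.add_one_le_exp (-(t ^ 2 / 5))
  have x3 : Real.exp (-(t ^ 2 / 4)) ≤ 1 - t ^ 2 / 4 + (t ^ 2 / 4) ^ 2 / 2 := by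
    have hx : 0 ≤ t ^ 2 / 4 := by positivity
    set x := t ^ 2 / 4
    have h1 := Real.quadratic_le_exp_of_nonneg hx
    rw [Real.exp_neg, inv_le_iff_one_le_mul₀ (Real.exp_pos x)]
    have h2 : 0 ≤ 1 - x + x ^ 2 / 2 := by nlinarith [sq_nonneg (x - 1)]
    nlinarith [mul_le_mul_of_nonneg_left h1 h2, pow_nonneg hx 4]
  constructor
  · rw [abs_le]
    constructor <;> nlinarith
  · rw [abs_le]
    constructor
    · have := Real.exp_pos (-(t ^ 2 / 5))
      nlinarith
    · nlinarith

lemma integral_cube_mul_exp_le {c : ℝ} (hc : 0 < c) :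
    ∫ t in (0 : ℝ)..1, t ^ 3 * Real.exp (-(c * t ^ 2)) ≤ 1 / (2 * c ^ 2) := by
  have hd : ∀ t ∈ uIcc (0 : ℝ) 1, HasDerivAt
      (fun t => -((t ^ 2 + 1 / c) * Real.exp (-(c * t ^ 2)) / (2 * c)))
      (t ^ 3 * Real.exp (-(c * t ^ 2))) t := by
    intro t _
    have h0 := ((hasDerivAt_pow 2 t).const_mul c).neg.exp
    have h1 := (((hasDerivAt_pow 2 t).add_const (1 / c)).mul h0).div_const (2 * c)
    refine h1.neg.congr_deriv ?_
    simp
    field_simp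
    ring
  rw [intervalIntegral.integral_eq_sub_of_hasDerivAt hd
    (Continuous.intervalIntegrable (by fun_prop) _ _)]
  have : 0 ≤ ((1 : ℝ) ^ 2 + 1 / c) * Real.exp (-(c * 1 ^ 2)) / (2 * c) := by positivity
  have h2 : ((0 : ℝ) ^ 2 + 1 / c) * Real.exp (-(c * 0 ^ 2)) / (2 * c) = 1 / (2 * c ^ 2) := by
    simp
    field_simp
  linarith

lemma cdf_gaussianReal_sub_le {v : NNReal} (hv : v ≠ 0) {x y : ℝ} (hxy : x ≤ y) :
    cdf (gaussianReal 0 v) y - cdf (gaussianReal 0 v) x ≤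
      (Real.sqrt (2 * Real.pi * v))⁻¹ * (y - x) := by
  rw [cdf_eq_real, cdf_eq_real, ← measureReal_sdiff (Iic_subset_Iic.2 hxy) measurableSet_Iic,
    Iic_sdiff_Iic, measureReal_def, gaussianReal_apply_eq_integral _ hv,
    ENNReal.toReal_ofReal (integral_nonneg fun _ => gaussianPDFReal_nonneg _ _ _)]
  calc ∫ z in Ioc x y, gaussianPDFReal 0 v z
      ≤ ∫ z in Ioc x y, (Real.sqrt (2 * Real.pi * v))⁻¹ := by
        refine integral_mono (integrable_gaussianPDFReal 0 v).integrableOn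
          (integrable_const _) fun z => ?_
        rw [gaussianPDFReal_def]
        refine mul_le_of_le_one_right (by positivity) (Real.exp_le_one_iff.2 ?_)
        rw [neg_div]
        exact neg_nonpos.2 (by positivity)
    _ = _ := by
        rw [setIntegral_const, Real.volume_real_Ioc_of_le hxy, smul_eq_mul, mul_comm]

/-- A Berry–Esseen bound for the mean-field sum. -/
theorem abs_cdf_quarterSum_sub_le {L : ℕ} (hL : 0 < L) (y : Fin L → ℝ) (x : ℝ) :
    |(noiseLaw L).real {w | quarterSum y w ≤ x} -
      cdf (gaussianReal 0 (Real.toNNReal (L / 2))) x| ≤ 8 / Real.sqrt L := by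
  have hL' : (0 : ℝ) < L := by exact_mod_cast hL
  have hL1 : (1 : ℝ) ≤ L := by exact_mod_cast hL
  have hv : ((Real.toNNReal ((L : ℝ) / 2) : NNReal) : ℝ) = L / 2 :=
    Real.coe_toNNReal _ (by positivity)
  have hv0 : Real.toNNReal ((L : ℝ) / 2) ≠ 0 := by
    rw [← NNReal.coe_ne_zero, hv]; positivity
  set v := Real.toNNReal ((L : ℝ) / 2) with hvdef
  set μ := (noiseLaw L).map (quarterSum y) with hμ
  have hprob : IsProbabilityMeasure μ :=
    Measure.isProbabilityMeasure_map (measurable_quarterSum y).aemeasurable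
  have hcdf : (noiseLaw L).real {w | quarterSum y w ≤ x} = cdf μ x := by
    rw [cdf_eq_real, hμ, map_measureReal_apply (measurable_quarterSum y) measurableSet_Iic]
    rfl
  rw [hcdf]
  -- Telescoping gives `L * t ^ 4 / 16 * exp (-(L / 5 * t ^ 2))` after multiplication by `q ≥ 4 /
  -- 5`, and `1 / 16 * 5 / 4 = 5 / 64`; one factor `t` is split off.
  set b : ℝ → ℝ := fun t => 5 / 64 * L * (t ^ 3 * Real.exp (-(L / 5 * t ^ 2))) with hb
  have hbi : IntervalIntegrable b volume 0 1 := Continuous.intervalIntegrable (by fun_prop) _ _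
  have hbound : ∀ t ∈ Ioc (0 : ℝ) 1,
      ‖charFun μ t - charFun (gaussianReal 0 v) t‖ ≤ t * b t := by
    intro t ht
    rw [hμ, charFun_map_quarterSum, charFun_gaussianReal]
    have h1 : Complex.exp (t * ((0 : ℝ) : ℂ) * Complex.I - ((v : ℝ) : ℂ) * t ^ 2 / 2) =
        ((Real.exp (-(t ^ 2 / 4)) ^ L : ℝ) : ℂ) := by
      rw [← Real.exp_nat_mul, hv]
      push_cast
      congr 1
      ring
    rw [h1, ← Complex.ofReal_sub, Complex.norm_real, Real.norm_eq_abs]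
    have hsc : ∀ j, Real.sin (2 * Real.pi * y j) ^ 2 + Real.cos (2 * Real.pi * y j) ^ 2 = 1 :=
      fun j => Real.sin_sq_add_cos_sq _
    have h2 := mul_abs_prod_sub_pow_le Finset.univ
      (fun j => (Real.cos (t * Real.sin (2 * Real.pi * y j)) +
        Real.cos (t * Real.cos (2 * Real.pi * y j))) / 2)
      (b := Real.exp (-(t ^ 2 / 4))) (q := Real.exp (-(t ^ 2 / 5))) (d := t ^ 4 / 16)
      (fun j => (symbol_charFun_bounds ht (hsc j)).2)
      (by rw [Real.abs_exp]; exact Real.exp_le_exp.2 (by nlinarith [sq_nonneg t]))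
      (fun j => (symbol_charFun_bounds ht (hsc j)).1)
    rw [Finset.card_univ, Fintype.card_fin] at h2
    set P := |∏ j, (Real.cos (t * Real.sin (2 * Real.pi * y j)) +
        Real.cos (t * Real.cos (2 * Real.pi * y j))) / 2 - Real.exp (-(t ^ 2 / 4)) ^ L| with hP
    have hq : 4 / 5 ≤ Real.exp (-(t ^ 2 / 5)) := by
      have := Real.add_one_le_exp (-(t ^ 2 / 5))
      have : t ^ 2 ≤ 1 := by nlinarith [ht.1, ht.2]
      linarith
    have hqL : Real.exp (-(t ^ 2 / 5)) ^ L = Real.exp (-(L / 5 * t ^ 2)) := by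
      rw [← Real.exp_nat_mul]; congr 1; ring
    rw [hqL] at h2
    have hP0 : 0 ≤ P := abs_nonneg _
    have h3 : 4 / 5 * P ≤ L * (t ^ 4 / 16) * Real.exp (-(L / 5 * t ^ 2)) :=
      (mul_le_mul_of_nonneg_right hq hP0).trans h2
    simp only [hb]
    linarith
  have hint : ∫ t in (0 : ℝ)..1, b t ≤ 1 / L := by
    simp only [hb]
    rw [intervalIntegral.integral_const_mul]
    have := integral_cube_mul_exp_le (c := (L : ℝ) / 5) (by positivity)
    calc _ ≤ 5 / 64 * (L : ℝ) * (1 / (2 * (L / 5) ^ 2)) := by gcongr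
      _ = 125 / 128 * (1 / L) := by field_simp; norm_num
      _ ≤ 1 / L := by
        have : 0 < 1 / (L : ℝ) := by positivity
        linarith
  have hmain := abs_cdf_sub_le_of_charFun μ (gaussianReal 0 v) hbi hbound
    (m := (Real.sqrt (2 * Real.pi * v))⁻¹) (fun a b hab => cdf_gaussianReal_sub_le hv0 hab) x
  refine hmain.trans ?_
  have hs : 1 ≤ Real.sqrt L := Real.one_le_sqrt.2 hL1
  have hss : Real.sqrt L * Real.sqrt L = L := Real.mul_self_sqrt hL'.le
  -- The constant `4 / 7` comes from `π > (7 / 4) ^ 2`.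
  have hm : (Real.sqrt (2 * Real.pi * v))⁻¹ ≤ 4 / 7 * (1 / Real.sqrt L) := by
    rw [hv, show 2 * Real.pi * ((L : ℝ) / 2) = Real.pi * L by ring,
      Real.sqrt_mul Real.pi_pos.le, mul_inv, one_div]
    gcongr
    rw [inv_le_comm₀ (by positivity) (by norm_num)]
    apply Real.le_sqrt_of_sq_le
    have := Real.pi_gt_d2
    norm_num
    linarith
  have hLs : 1 / (L : ℝ) ≤ 1 / Real.sqrt L := by
    apply one_div_le_one_div_of_le (by positivity)
    nlinarith
  have : 8 / Real.sqrt L = 8 * (1 / Real.sqrt L) := by ring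
  rw [this]
  have h0 : 0 < 1 / Real.sqrt L := by positivity
  -- The total is `64 / 7 * 4 / 7 + 18 / 7 = 382 / 49 < 8`.
  linarith

/-! ### One step of the network on the circle -/

lemma coe_rep (x : UnitAddCircle) : ((rep x : ℝ) : UnitAddCircle) = x :=
  AddCircle.coe_equivIco

lemma sinTwoPi_coe (a : ℝ) : sinTwoPi (a : UnitAddCircle) = Real.sin (2 * Real.pi * a) := by
  have h : rep (a : UnitAddCircle) = Int.fract a := by
    have := AddCircle.coe_equivIco_mk_apply (p := (1 : ℝ)) a
    rw [div_one, mul_one] at this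
    exact this
  rw [sinTwoPi, h, Int.fract,
    show 2 * Real.pi * (a - ⌊a⌋) = 2 * Real.pi * a - ⌊a⌋ * (2 * Real.pi) by ring,
    Real.sin_sub_int_mul_two_pi]

lemma sinTwoPi_add_coe (x : UnitAddCircle) (r : ℝ) :
    sinTwoPi (x + (r : UnitAddCircle)) = Real.sin (2 * Real.pi * (rep x + r)) := by
  conv_lhs => rw [← coe_rep x, ← AddCircle.coe_add]
  exact sinTwoPi_coe _

lemma abs_sinTwoPi_add_sub_le (x : UnitAddCircle) (r : ℝ) :
    |sinTwoPi (x + (r : UnitAddCircle)) - sinTwoPi x| ≤ 2 * Real.pi * |r| := by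
  rw [sinTwoPi_add_coe, sinTwoPi]
  refine (Real.abs_sin_sub_sin_le _ _).trans (le_of_eq ?_)
  rw [← mul_sub, add_sub_cancel_left, abs_mul, abs_of_pos (by positivity)]

lemma abs_sinTwoPi_le_one (x : UnitAddCircle) : |sinTwoPi x| ≤ 1 := Real.abs_sin_le_one _

/-- The real lift of `nodeMap 0`. -/
def foldHeight (x : UnitAddCircle) : ℝ := if rep x ≤ 1 / 2 then rep x / 2 else (1 - rep x) / 2

lemma nodeMap_eq (ω : Fin 4) (x : UnitAddCircle) :
    nodeMap ω x = ((foldHeight x + (ω.val : ℝ) / 4 : ℝ) : UnitAddCircle) := by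
  unfold nodeMap foldHeight
  split_ifs <;> rfl

/-- The mean field of a state. -/
def meanField (L : ℕ) (α : ℝ) (x : State L) : ℝ := α / (L : ℝ) * ∑ j : Fin L, sinTwoPi (x j.succ)

lemma fluct_eq_meanField (L : ℕ) (α : ℝ) (t : ℕ) (p : Noise L × State L) :
    fluct L α t p = meanField L α (orbit L α p.1 p.2 t) := rfl

lemma abs_coupling_le (ω : Fin 4) (x y : UnitAddCircle) : |coupling ω x y| ≤ 17 / 6 := by
  have h1 := abs_le.1 (abs_sinTwoPi_le_one x)
  have h2 := abs_le.1 (abs_sinTwoPi_le_one y)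
  have h3 : (ω.val : ℝ) ≤ 3 := by
    have := ω.isLt
    exact_mod_cast Nat.lt_succ_iff.1 this
  have h4 : (0 : ℝ) ≤ ω.val := Nat.cast_nonneg _
  unfold coupling
  rw [abs_le]
  constructor <;> norm_num <;> linarith

/-- After one step, the mean field is close to a scaled sum over quarter translates. -/
lemma abs_meanField_step_sub_le {L : ℕ} (hL : 0 < L) {α : ℝ} (hα : 0 < α)
    (w : Fin (L + 1) → Fin 4) (x : State L) :
    |meanField L α (step L α w x) -
      α / L * quarterSum (fun j => foldHeight (x j.succ)) w| ≤ 18 * α ^ 2 / L := by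
  have hL' : (0 : ℝ) < L := by exact_mod_cast hL
  have hj : ∀ j : Fin L, |sinTwoPi (step L α w x j.succ) -
      Real.sin (2 * Real.pi * (foldHeight (x j.succ) + ((w j.succ).val : ℝ) / 4))| ≤
      18 * (α / L) := by
    intro j
    have h := abs_sinTwoPi_add_sub_le (nodeMap (w j.succ) (x j.succ))
      (α / L * coupling (w j.succ) (x j.succ) (x 0))
    have h2 : sinTwoPi (nodeMap (w j.succ) (x j.succ)) =
        Real.sin (2 * Real.pi * (foldHeight (x j.succ) + ((w j.succ).val : ℝ) / 4)) := by
      rw [nodeMap_eq, sinTwoPi_coe]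
    rw [h2] at h
    have h3 : step L α w x j.succ = nodeMap (w j.succ) (x j.succ) +
      ((α / (L : ℝ) * coupling (w j.succ) (x j.succ) (x 0) : ℝ) : UnitAddCircle) := by
      simp [step]
    rw [h3]
    refine h.trans ?_
    rw [abs_mul, abs_of_pos (by positivity : 0 < α / L)]
    -- Here `2 * 3.15 * 17 / 6 = 17.85`, which is rounded up to `18`.
    calc 2 * Real.pi * (α / L * |coupling (w j.succ) (x j.succ) (x 0)|)
        ≤ 2 * 3.15 * (α / L * (17 / 6)) := by
          gcongr
          · exact Real.pi_lt_d2.le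
          · exact abs_coupling_le _ _ _
      _ ≤ 18 * (α / L) := by
          have : 0 < α / L := by positivity
          norm_num
          linarith
  rw [meanField, quarterSum, ← mul_sub, ← Finset.sum_sub_distrib, abs_mul,
    abs_of_pos (by positivity : 0 < α / L)]
  calc α / L * |∑ j : Fin L, (sinTwoPi (step L α w x j.succ) -
        Real.sin (2 * Real.pi * (foldHeight (x j.succ) + ((w j.succ).val : ℝ) / 4)))|
      ≤ α / L * ∑ j : Fin L, 18 * (α / L) := by
        gcongr
        exact (Finset.abs_sum_le_sum_abs _ _).trans (Finset.sum_le_sum fun j _ => hj j)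
    _ = 18 * α ^ 2 / L := by
        simp
        field_simp

/-! ### Measurability of the dynamics -/

lemma measurable_rep : Measurable rep :=
  measurable_subtype_coe.comp (AddCircle.measurableEquivIco 1 0).measurable

@[fun_prop]
lemma measurable_sinTwoPi : Measurable sinTwoPi := by
  have := measurable_rep
  unfold sinTwoPi
  fun_prop

lemma measurable_nodeMap (ω : Fin 4) : Measurable (nodeMap ω) := by
  have := measurable_rep
  have hc : Measurable fun a : ℝ => (a : UnitAddCircle) := (AddCircle.continuous_mk' 1).measurable
  refine Measurable.ite (measurableSet_le this measurable_const) (hc.comp ?_) (hc.comp ?_) <;>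
    fun_prop

lemma measurable_step (L : ℕ) (α : ℝ) (w : Fin (L + 1) → Fin 4) : Measurable (step L α w) := by
  have hc : Measurable fun a : ℝ => (a : UnitAddCircle) := (AddCircle.continuous_mk' 1).measurable
  rw [measurable_pi_iff]
  intro i
  refine Fin.cases ?_ (fun j => ?_) i
  · have h1 : Measurable fun x : State L => nodeMap (w 0) (x 0) :=
      (measurable_nodeMap _).comp (measurable_pi_apply _)
    have h2 : Measurable fun x : State L =>
        α / (L : ℝ) * ∑ j : Fin L, coupling (w 0) (x 0) (x j.succ) := by
      unfold coupling
      fun_prop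
    exact h1.add (hc.comp h2)
  · have h1 : Measurable fun x : State L => nodeMap (w j.succ) (x j.succ) :=
      (measurable_nodeMap _).comp (measurable_pi_apply _)
    have h2 : Measurable fun x : State L =>
        α / (L : ℝ) * coupling (w j.succ) (x j.succ) (x 0) := by
      unfold coupling
      fun_prop
    exact h1.add (hc.comp h2)

lemma measurable_uncurry_step (L : ℕ) (α : ℝ) :
    Measurable fun q : (Fin (L + 1) → Fin 4) × State L => step L α q.1 q.2 :=
  measurable_from_prod_countable_right fun w => measurable_step L α w

lemma measurable_orbit (L : ℕ) (α : ℝ) (t : ℕ) :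
    Measurable fun p : Noise L × State L => orbit L α p.1 p.2 t := by
  induction t with
  | zero => exact measurable_snd
  | succ t ih =>
    have h : Measurable fun p : Noise L × State L => fun i => p.1 (t, i) := by fun_prop
    have h2 : Measurable fun p : Noise L × State L =>
        ((fun i => p.1 (t, i) : Fin (L + 1) → Fin 4), orbit L α p.1 p.2 t) := h.prodMk ih
    simp only [orbit]
    have h3 := (measurable_uncurry_step L α).comp h2
    simp only [Function.comp_def] at h3
    exact h3

lemma measurable_meanField (L : ℕ) (α : ℝ) : Measurable (meanField L α) := by
  unfold meanField
  fun_prop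

lemma measurable_fluct (L : ℕ) (α : ℝ) (t : ℕ) : Measurable (fluct L α t) :=
  (measurable_meanField L α).comp (measurable_orbit L α t)

/-! ### The mean-field equation of the hub -/

lemma integrable_sinTwoPi : Integrable sinTwoPi :=
  Integrable.mono' (integrable_const 1) measurable_sinTwoPi.aestronglyMeasurable
    (Eventually.of_forall abs_sinTwoPi_le_one)

/-- A half turn preserves the measure and changes the sign of the sine. -/
lemma integral_sinTwoPi : ∫ y, sinTwoPi y = 0 := by
  have h := integral_add_right_eq_self (μ := (volume : Measure UnitAddCircle)) sinTwoPi
    ((1 / 2 : ℝ) : UnitAddCircle)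
  have h2 : ∀ y, sinTwoPi (y + ((1 / 2 : ℝ) : UnitAddCircle)) = -sinTwoPi y := by
    intro y
    rw [sinTwoPi_add_coe, sinTwoPi, ← Real.sin_add_pi]
    congr 1
    ring
  simp_rw [h2] at h
  rw [integral_neg] at h
  linarith

lemma integral_coupling (ω : Fin 4) (z : UnitAddCircle) :
    ∫ y, coupling ω z y = -sinTwoPi z - (ω.val : ℝ) / 3.6 := by
  unfold coupling
  simp_rw [sub_sub]
  rw [integral_sub integrable_sinTwoPi (integrable_const _), integral_sinTwoPi, integral_const]
  simp [measureReal_def]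
  ring

/-- The sine has mean zero, so the empirical coupling differs from its integral exactly by the
average of the sines. -/
lemma orbit_succ_hub {L : ℕ} (hL : 0 < L) (α : ℝ) (p : Noise L × State L) (t : ℕ) :
    orbit L α p.1 p.2 (t + 1) 0 =
      reducedMap α (p.1 (t, 0)) (orbit L α p.1 p.2 t 0) +
        ((fluct L α t p : ℝ) : UnitAddCircle) := by
  have hL' : (L : ℝ) ≠ 0 := by exact_mod_cast hL.ne'
  rw [orbit, step, Fin.cons_zero, reducedMap, integral_coupling, add_assoc, ← AddCircle.coe_add]
  congr 2
  simp only [coupling, fluct, Finset.sum_sub_distrib, Finset.sum_const, Finset.card_univ,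
    Fintype.card_fin, nsmul_eq_mul]
  field_simp
  ring

/-! ### Resampling as a substitute for conditioning -/

/-- Replace the noise at time `t` by `w`. -/
def resampleNoise {L : ℕ} (t : ℕ) (ω : Noise L) (w : Fin (L + 1) → Fin 4) : Noise L :=
  fun i => if i.1 = t then w i.2 else ω i

/-- The law of the whole noise. -/
abbrev noisePathLaw (L : ℕ) : Measure (Noise L) := Measure.infinitePi fun _ => symbolLaw

lemma measurable_resampleNoise (L t : ℕ) :
    Measurable fun q : Noise L × (Fin (L + 1) → Fin 4) => resampleNoise t q.1 q.2 := by
  rw [measurable_pi_iff]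
  intro i
  unfold resampleNoise
  split_ifs <;> fun_prop

/-- Checked on cylinders: the constraints split into those at time `t`, which fall on the fresh
block, and the others, which fall on the old noise. -/
lemma measurePreserving_resampleNoise (L t : ℕ) :
    MeasurePreserving (fun q : Noise L × (Fin (L + 1) → Fin 4) => resampleNoise t q.1 q.2)
      ((noisePathLaw L).prod (noiseLaw L)) (noisePathLaw L) := by
  classical
  refine ⟨measurable_resampleNoise L t, Measure.eq_infinitePi _ fun s T hT => ?_⟩
  rw [Measure.map_apply (measurable_resampleNoise L t)
    (MeasurableSet.pi (Finset.countable_toSet s) fun i _ => hT i)]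
  have hpre : (fun q : Noise L × (Fin (L + 1) → Fin 4) => resampleNoise t q.1 q.2) ⁻¹'
      ((s : Set (ℕ × Fin (L + 1))).pi T) =
      ((s.filter fun i => ¬ i.1 = t : Finset (ℕ × Fin (L + 1))) : Set (ℕ × Fin (L + 1))).pi T ×ˢ
        (univ.pi fun i => if (t, i) ∈ s then T (t, i) else univ) := by
    ext ⟨ω, w⟩
    simp only [mem_preimage, Set.mem_pi, Finset.mem_coe, mem_prod, Finset.mem_filter, mem_univ,
      forall_true_left, resampleNoise]
    constructor
    · intro h
      refine ⟨fun i hi => ?_, fun i => ?_⟩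
      · simpa [hi.2] using h i hi.1
      · split_ifs with hi
        · simpa using h _ hi
        · trivial
    · rintro ⟨h1, h2⟩ ⟨u, i⟩ hi
      split_ifs with hu
      · simp only at hu
        subst hu
        simpa [hi] using h2 i
      · exact h1 _ ⟨hi, hu⟩
  rw [hpre, Measure.prod_prod, Measure.infinitePi_pi _ (fun i _ => hT i), Measure.pi_pi,
    ← Finset.prod_filter_mul_prod_filter_not s (fun i => i.1 = t), mul_comm]
  congr 1
  have himg : s.filter (fun i => i.1 = t) =
      (Finset.univ.filter fun i : Fin (L + 1) => (t, i) ∈ s).image fun i => (t, i) := by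
    ext ⟨u, i⟩
    simp only [Finset.mem_filter, Finset.mem_image, Finset.mem_univ, true_and, Prod.mk.injEq]
    constructor
    · rintro ⟨h, rfl⟩
      exact ⟨i, h, rfl, rfl⟩
    · rintro ⟨_, h, rfl, rfl⟩
      exact ⟨h, rfl⟩
  rw [himg, Finset.prod_image (fun a _ b _ h => (Prod.mk.inj h).2), Finset.prod_filter]
  refine Finset.prod_congr rfl fun i _ => ?_
  split_ifs <;> simp

instance isProbabilityMeasure_volume_state (L : ℕ) :
    IsProbabilityMeasure (volume : Measure (State L)) := by
  have : IsProbabilityMeasure (volume : Measure UnitAddCircle) := ⟨by simp⟩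
  rw [volume_pi]
  infer_instance

instance isProbabilityMeasure_starProb (L : ℕ) : IsProbabilityMeasure (starProb L) := by
  unfold starProb
  infer_instance

/-- Replace the noise at time `t` of a realization by `w`. -/
def resample {L : ℕ} (t : ℕ) (q : (Noise L × State L) × (Fin (L + 1) → Fin 4)) :
    Noise L × State L := (resampleNoise t q.1.1 q.2, q.1.2)

lemma measurePreserving_resample (L t : ℕ) :
    MeasurePreserving (resample (L := L) t) ((starProb L).prod (noiseLaw L)) (starProb L) := by
  have e1 : MeasurePreserving MeasurableEquiv.prodAssoc
      (((noisePathLaw L).prod (volume : Measure (State L))).prod (noiseLaw L))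
      ((noisePathLaw L).prod ((volume : Measure (State L)).prod (noiseLaw L))) :=
    ⟨MeasurableEquiv.measurable _, Measure.prodAssoc_prod⟩
  have e2 := (MeasurePreserving.id (noisePathLaw L)).prod
    (Measure.measurePreserving_swap (μ := (volume : Measure (State L))) (ν := noiseLaw L))
  have e3 : MeasurePreserving MeasurableEquiv.prodAssoc
      (((noisePathLaw L).prod (noiseLaw L)).prod (volume : Measure (State L)))
      ((noisePathLaw L).prod ((noiseLaw L).prod (volume : Measure (State L)))) :=
    ⟨MeasurableEquiv.measurable _, Measure.prodAssoc_prod⟩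
  have e4 := (measurePreserving_resampleNoise L t).prod
    (MeasurePreserving.id (volume : Measure (State L)))
  exact e4.comp ((e3.symm _).comp (e2.comp e1))

/-- The symbols of time `t` first influence the state at time `t + 1`, so `s = t` is allowed. -/
lemma orbit_resample_of_le {L : ℕ} (α : ℝ) {s t : ℕ} (hst : s ≤ t) (p : Noise L × State L)
    (w : Fin (L + 1) → Fin 4) :
    orbit L α (resample t (p, w)).1 (resample t (p, w)).2 s = orbit L α p.1 p.2 s := by
  induction s with
  | zero => rfl
  | succ s ih =>
    rw [orbit, orbit, ih (by omega)]
    congr 1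
    ext i
    simp [resample, resampleNoise, show s ≠ t by omega]

lemma orbit_succ_resample {L : ℕ} (α : ℝ) (t : ℕ) (p : Noise L × State L)
    (w : Fin (L + 1) → Fin 4) :
    orbit L α (resample t (p, w)).1 (resample t (p, w)).2 (t + 1) =
      step L α w (orbit L α p.1 p.2 t) := by
  rw [orbit, orbit_resample_of_le α le_rfl]
  congr 1
  ext i
  simp [resample, resampleNoise]

/-- Rotate the initial state by the quarters `w`. -/
def rotateStart {L : ℕ} (q : (Noise L × State L) × (Fin (L + 1) → Fin 4)) :
    Noise L × State L :=
  (q.1.1, q.1.2 + fun i => ((((q.2 i).val : ℝ) / 4 : ℝ) : UnitAddCircle))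

/-- For each fixed `w` this is a translation of the torus; a skew product then averages over `w`. -/
lemma measurePreserving_rotateStart (L : ℕ) :
    MeasurePreserving (rotateStart (L := L)) ((starProb L).prod (noiseLaw L)) (starProb L) := by
  have hmp : ∀ w : Fin (L + 1) → Fin 4, MeasurePreserving
      (fun p : Noise L × State L => rotateStart (p, w)) (starProb L) (starProb L) := fun w =>
    (MeasurePreserving.id (noisePathLaw L)).prod
      (measurePreserving_add_right (volume : Measure (State L))
        (fun i => ((((w i).val : ℝ) / 4 : ℝ) : UnitAddCircle)))
  have hsk := (MeasurePreserving.id (noiseLaw L)).skew_product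
    (g := fun w p => rotateStart (L := L) (p, w)) (μc := starProb L) (μd := starProb L)
    (measurable_from_prod_countable_right fun w => (hmp w).measurable)
    (Eventually.of_forall fun w => (hmp w).map_eq)
  exact (measurePreserving_snd.comp hsk).comp Measure.measurePreserving_swap

/-- At every time, conditionally on the past, the fluctuation is close to a scaled sum over
independent quarter translates. -/
lemma exists_resampling {L : ℕ} (hL : 0 < L) {α : ℝ} (hα : 0 < α) (t : ℕ) :
    ∃ R : (Noise L × State L) × (Fin (L + 1) → Fin 4) → Noise L × State L,
      MeasurePreserving R ((starProb L).prod (noiseLaw L)) (starProb L) ∧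
      ∀ p, ∃ y : Fin L → ℝ, ∀ w,
        |fluct L α t (R (p, w)) - α / L * quarterSum y w| ≤ 18 * α ^ 2 / L := by
  cases t with
  | zero =>
    -- No noise has acted at time `0`; this is where the uniformity of the initial state enters.
    refine ⟨rotateStart, measurePreserving_rotateStart L, fun p =>
      ⟨fun j => rep (p.2 j.succ), fun w => ?_⟩⟩
    have : fluct L α 0 (rotateStart (p, w)) =
        α / L * quarterSum (fun j => rep (p.2 j.succ)) w := by
      simp only [fluct, orbit, rotateStart, quarterSum, Pi.add_apply, sinTwoPi_add_coe]
    rw [this, sub_self, abs_zero]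
    positivity
  | succ t =>
    refine ⟨resample t, measurePreserving_resample L t, fun p =>
      ⟨fun j => foldHeight (orbit L α p.1 p.2 t j.succ), fun w => ?_⟩⟩
    rw [fluct_eq_meanField, orbit_succ_resample]
    exact abs_meanField_step_sub_le hL hα w _

/-! ### From conditional to unconditional bounds -/

lemma noiseLaw_abs_gt_le {L : ℕ} (hL : 0 < L) {α : ℝ} (hα : 0 < α) {y : Fin L → ℝ}
    {F : (Fin (L + 1) → Fin 4) → ℝ}
    (hF : ∀ w, |F w - α / L * quarterSum y w| ≤ 18 * α ^ 2 / L) {ε : ℝ}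
    (hr : 0 ≤ L * ε / α - 18 * α) :
    (noiseLaw L).real {w | ε < |F w|} ≤
      2 * Real.exp (-((L * ε / α - 18 * α) ^ 2 / (2 * L))) := by
  have hL' : (0 : ℝ) < L := by exact_mod_cast hL
  refine (measureReal_mono ?_).trans (noiseLaw_abs_quarterSum_gt_le hL y hr)
  intro w hw
  have hw' : ε < |F w| := hw
  have h1 : |F w| ≤ α / L * |quarterSum y w| + 18 * α ^ 2 / L := by
    have h2 := abs_sub_abs_le_abs_sub (F w) (α / L * quarterSum y w)
    rw [abs_mul, abs_of_pos (by positivity : 0 < α / (L : ℝ))] at h2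
    linarith [hF w]
  have h3 : ε < α / L * |quarterSum y w| + 18 * α ^ 2 / L := hw'.trans_le h1
  change L * ε / α - 18 * α < |quarterSum y w|
  have h4 : L * ε / α < L / α * (α / L * |quarterSum y w| + 18 * α ^ 2 / L) := by
    rw [mul_div_right_comm]
    exact mul_lt_mul_of_pos_left h3 (by positivity)
  have h5 : L / α * (α / L * |quarterSum y w| + 18 * α ^ 2 / L) =
      |quarterSum y w| + 18 * α := by
    field_simp
  linarith

lemma cdf_gaussianReal_scale {L : ℕ} (hL : 0 < L) {α : ℝ} (hα : 0 < α) (s : ℝ) :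
    cdf (gaussianReal 0 (Real.toNNReal (α ^ 2 / (2 * (L : ℝ))))) s =
      cdf (gaussianReal 0 (Real.toNNReal ((L : ℝ) / 2))) (L / α * s) := by
  have hL' : (0 : ℝ) < L := by exact_mod_cast hL
  have h := gaussianReal_map_const_mul (μ := 0) (v := Real.toNNReal ((L : ℝ) / 2)) (α / L)
  have hv : (NNReal.mk ((α / L) ^ 2) (sq_nonneg _)) * Real.toNNReal ((L : ℝ) / 2) =
      Real.toNNReal (α ^ 2 / (2 * (L : ℝ))) := by
    rw [← NNReal.coe_inj, NNReal.coe_mul, Real.coe_toNNReal _ (by positivity),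
      Real.coe_toNNReal _ (by positivity)]
    change (α / L) ^ 2 * (L / 2 : ℝ) = _
    field_simp
  rw [mul_zero, hv] at h
  rw [cdf_eq_real, cdf_eq_real, ← h,
    map_measureReal_apply (by fun_prop) measurableSet_Iic]
  congr 1
  ext x
  simp only [mem_preimage, mem_Iic]
  rw [div_mul_eq_mul_div, div_mul_eq_mul_div, div_le_iff₀ hL', le_div_iff₀ hα, mul_comm α,
    mul_comm s]

lemma noiseLaw_le_mem_Icc {L : ℕ} (hL : 0 < L) {α : ℝ} (hα : 0 < α) {y : Fin L → ℝ}
    {F : (Fin (L + 1) → Fin 4) → ℝ}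
    (hF : ∀ w, |F w - α / L * quarterSum y w| ≤ 18 * α ^ 2 / L) (s : ℝ) :
    (noiseLaw L).real {w | F w ≤ s} ∈ Icc
      (cdf (gaussianReal 0 (Real.toNNReal (α ^ 2 / (2 * (L : ℝ))))) (s - 36 * α ^ 2 / L) -
        8 / Real.sqrt L)
      (cdf (gaussianReal 0 (Real.toNNReal (α ^ 2 / (2 * (L : ℝ))))) (s + 36 * α ^ 2 / L) +
        8 / Real.sqrt L) := by
  have hL' : (0 : ℝ) < L := by exact_mod_cast hL
  have hpos : 0 < L / α := by positivity
  -- A shift by `18 * α ^ 2 / L` already covers the coupling error; the other half is slack.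
  have hd : 36 * α ^ 2 / L = 2 * (18 * α ^ 2 / L) := by ring
  have hd0 : 0 ≤ 18 * α ^ 2 / L := by positivity
  rw [cdf_gaussianReal_scale hL hα, cdf_gaussianReal_scale hL hα]
  have hb := abs_cdf_quarterSum_sub_le hL y
  have hQ : ∀ w, quarterSum y w = L / α * (α / L * quarterSum y w) := fun w => by field_simp
  constructor
  · have h1 := (abs_le.1 (hb (L / α * (s - 36 * α ^ 2 / L)))).1
    have h2 : (noiseLaw L).real {w | quarterSum y w ≤ L / α * (s - 36 * α ^ 2 / L)} ≤
        (noiseLaw L).real {w | F w ≤ s} := by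
      refine measureReal_mono fun w hw => ?_
      have hw' : quarterSum y w ≤ L / α * (s - 36 * α ^ 2 / L) := hw
      rw [hQ, mul_le_mul_iff_right₀ hpos] at hw'
      change F w ≤ s
      linarith [(abs_le.1 (hF w)).2]
    linarith
  · have h1 := (abs_le.1 (hb (L / α * (s + 36 * α ^ 2 / L)))).2
    have h2 : (noiseLaw L).real {w | F w ≤ s} ≤
        (noiseLaw L).real {w | quarterSum y w ≤ L / α * (s + 36 * α ^ 2 / L)} := by
      refine measureReal_mono fun w hw => ?_
      have hw' : F w ≤ s := hw
      change quarterSum y w ≤ L / α * (s + 36 * α ^ 2 / L)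
      rw [hQ, mul_le_mul_iff_right₀ hpos]
      linarith [(abs_le.1 (hF w)).1]
    linarith

/-- Bounds on a probability that hold conditionally on the past. -/
lemma starProb_mem_Icc_of_resampling {L : ℕ}
    {R : (Noise L × State L) × (Fin (L + 1) → Fin 4) → Noise L × State L}
    (hR : MeasurePreserving R ((starProb L).prod (noiseLaw L)) (starProb L))
    {E : Set (Noise L × State L)} (hE : MeasurableSet E) {a b : ℝ}
    (h : ∀ p, (noiseLaw L).real {w | R (p, w) ∈ E} ∈ Icc a b) :
    (starProb L).real E ∈ Icc a b := by
  have hmeas : MeasurableSet (R ⁻¹' E) := hR.measurable hE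
  have h1 : (starProb L).real E = ∫ p, (noiseLaw L).real {w | R (p, w) ∈ E} ∂(starProb L) := by
    rw [measureReal_def, ← hR.measure_preimage hE.nullMeasurableSet,
      Measure.prod_apply hmeas, ← integral_toReal
        (measurable_measure_prodMk_left hmeas).aemeasurable
        (Eventually.of_forall fun p => measure_lt_top _ _)]
    rfl
  have hi : Integrable (fun p => (noiseLaw L).real {w | R (p, w) ∈ E}) (starProb L) := by
    refine Integrable.mono' (integrable_const 1)
      (measurable_measure_prodMk_left hmeas).ennreal_toReal.aestronglyMeasurable
      (Eventually.of_forall fun p => ?_)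
    rw [Real.norm_of_nonneg measureReal_nonneg]
    exact measureReal_le_one
  rw [h1]
  constructor
  · have := integral_mono (integrable_const a) hi fun p => (h p).1
    simpa using this
  · have := integral_mono hi (integrable_const b) fun p => (h p).2
    simpa using this

lemma starProb_abs_fluct_gt_le {L : ℕ} (hL : 0 < L) {α : ℝ} (hα : 0 < α) {ε : ℝ}
    (hr : 0 ≤ L * ε / α - 18 * α) (t : ℕ) :
    (starProb L).real {p | ε < |fluct L α t p|} ≤
      2 * Real.exp (-((L * ε / α - 18 * α) ^ 2 / (2 * L))) := by
  obtain ⟨R, hR, hy⟩ := exists_resampling hL hα t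
  refine (starProb_mem_Icc_of_resampling hR (a := 0) (measurableSet_lt measurable_const
    (measurable_fluct L α t).abs) fun p => ⟨measureReal_nonneg, ?_⟩).2
  obtain ⟨y, hy⟩ := hy p
  exact noiseLaw_abs_gt_le hL hα hy hr

theorem starProb_fluct_le_mem_Icc {L : ℕ} (hL : 0 < L) {α : ℝ} (hα : 0 < α) (t : ℕ) (s : ℝ) :
    (starProb L).real {p | fluct L α t p ≤ s} ∈ Icc
      (cdf (gaussianReal 0 (Real.toNNReal (α ^ 2 / (2 * (L : ℝ))))) (s - 36 * α ^ 2 / L) -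
        8 / Real.sqrt L)
      (cdf (gaussianReal 0 (Real.toNNReal (α ^ 2 / (2 * (L : ℝ))))) (s + 36 * α ^ 2 / L) +
        8 / Real.sqrt L) := by
  obtain ⟨R, hR, hy⟩ := exists_resampling hL hα t
  refine starProb_mem_Icc_of_resampling hR (measurableSet_le (measurable_fluct L α t)
    measurable_const) fun p => ?_
  obtain ⟨y, hy⟩ := hy p
  exact noiseLaw_le_mem_Icc hL hα hy s

/-! ### Frequency of excursions -/

/-- The number of times before `T` at which the fluctuation exceeds `ε`. -/
def excursions (L : ℕ) (α ε : ℝ) (T : ℕ) (p : Noise L × State L) : ℝ :=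
  ∑ t ∈ Finset.range T, {p | ε < |fluct L α t p|}.indicator (fun _ => (1 : ℝ)) p

lemma measurableSet_fluct_gt (L : ℕ) (α ε : ℝ) (t : ℕ) :
    MeasurableSet {p | ε < |fluct L α t p|} :=
  measurableSet_lt measurable_const (measurable_fluct L α t).abs

lemma measurable_excursions (L : ℕ) (α ε : ℝ) (T : ℕ) : Measurable (excursions L α ε T) :=
  Finset.measurable_sum _ fun t _ => measurable_const.indicator (measurableSet_fluct_gt L α ε t)

lemma excursions_le (L : ℕ) (α ε : ℝ) (T : ℕ) (p : Noise L × State L) :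
    excursions L α ε T p ≤ T := by
  calc _ ≤ ∑ t ∈ Finset.range T, (1 : ℝ) :=
        Finset.sum_le_sum fun t _ => indicator_le_self' (fun _ _ => zero_le_one) p
    _ = T := by simp

lemma integrable_exp_excursions (L : ℕ) (α ε : ℝ) (T : ℕ) :
    Integrable (fun p => Real.exp (excursions L α ε T p)) (starProb L) := by
  refine Integrable.mono' (integrable_const (Real.exp T))
    (measurable_excursions L α ε T).exp.aestronglyMeasurable (Eventually.of_forall fun p => ?_)
  rw [Real.norm_of_nonneg (Real.exp_pos _).le]
  exact Real.exp_le_exp.2 (excursions_le L α ε T p)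

/-- The exponential of an indicator is affine in it, with slope `exp 1 - 1 < 2`. -/
lemma integral_exp_indicator_le {L : ℕ} (S : Set (Fin (L + 1) → Fin 4)) {δ : ℝ}
    (hS : (noiseLaw L).real S ≤ δ) :
    ∫ w, Real.exp (S.indicator (fun _ => (1 : ℝ)) w) ∂(noiseLaw L) ≤ Real.exp (2 * δ) := by
  have h1 : ∀ w, Real.exp (S.indicator (fun _ => (1 : ℝ)) w) =
      1 + S.indicator (fun _ => Real.exp 1 - 1) w := by
    intro w
    by_cases hw : w ∈ S <;> simp [hw]
  simp_rw [h1]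
  rw [integral_add (integrable_const _) (integrable_noiseLaw _),
    integral_indicator (Set.toFinite S).measurableSet, setIntegral_const]
  have he := Real.exp_one_lt_d9
  have h0 : 0 ≤ (noiseLaw L).real S := measureReal_nonneg
  have h2 := Real.add_one_le_exp (2 * δ)
  simp only [integral_const, probReal_univ, smul_eq_mul, mul_one]
  nlinarith

/-- Resampling the noise of time `T` fixes all excursions up to time `T` and makes the one at `T +
1` have conditional probability at most `δ`. Time `0` is counted trivially, whence the factor `exp
1` and the exponent `T` for `T + 1` times. -/
lemma integral_exp_excursions_le {L : ℕ} (hL : 0 < L) {α : ℝ} (hα : 0 < α) {ε δ : ℝ}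
    (hr : 0 ≤ L * ε / α - 18 * α)
    (hδ : 2 * Real.exp (-((L * ε / α - 18 * α) ^ 2 / (2 * L))) ≤ δ) (T : ℕ) :
    ∫ p, Real.exp (excursions L α ε (T + 1) p) ∂(starProb L) ≤
      Real.exp 1 * Real.exp (2 * δ) ^ T := by
  induction T with
  | zero =>
    have := integral_mono (integrable_exp_excursions L α ε 1) (integrable_const (Real.exp 1))
      fun p => Real.exp_le_exp.2 (by simpa using excursions_le L α ε 1 p)
    simpa using this
  | succ T ih =>
    have hmp := measurePreserving_resample L T
    have hint := integrable_exp_excursions L α ε (T + 2)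
    have hV : ∀ p w, Real.exp (excursions L α ε (T + 2) (resample T (p, w))) =
        Real.exp (excursions L α ε (T + 1) p) *
          Real.exp ({w | ε < |meanField L α (step L α w (orbit L α p.1 p.2 T))|}.indicator
            (fun _ => (1 : ℝ)) w) := by
      intro p w
      rw [← Real.exp_add]
      congr 1
      rw [excursions, Finset.sum_range_succ, excursions]
      congr 1
      · refine Finset.sum_congr rfl fun t ht => ?_
        have ht' : t ≤ T := Nat.lt_succ_iff.1 (Finset.mem_range.1 ht)
        simp only [indicator, mem_ofPred_eq, fluct_eq_meanField, orbit_resample_of_le α ht']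
        congr
      · simp only [indicator, mem_ofPred_eq, fluct_eq_meanField, orbit_succ_resample]
    have hcomp : Integrable
        (fun q => Real.exp (excursions L α ε (T + 2) (resample T q)))
        ((starProb L).prod (noiseLaw L)) := hmp.integrable_comp_of_integrable hint
    have hchange : ∫ p, Real.exp (excursions L α ε (T + 2) p) ∂(starProb L) =
        ∫ p, ∫ w, Real.exp (excursions L α ε (T + 2) (resample T (p, w))) ∂(noiseLaw L)
          ∂(starProb L) := by
      rw [← integral_prod _ hcomp]
      conv_lhs => rw [← hmp.map_eq]
      exact integral_map hmp.measurable.aemeasurable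
        (by rw [hmp.map_eq]; exact hint.aestronglyMeasurable)
    have hinner : ∀ p, ∫ w, Real.exp (excursions L α ε (T + 2) (resample T (p, w)))
        ∂(noiseLaw L) ≤ Real.exp (excursions L α ε (T + 1) p) * Real.exp (2 * δ) := by
      intro p
      simp_rw [hV p]
      rw [integral_const_mul]
      refine mul_le_mul_of_nonneg_left (integral_exp_indicator_le _ ?_) (Real.exp_pos _).le
      exact (noiseLaw_abs_gt_le hL hα
        (fun w => abs_meanField_step_sub_le hL hα w (orbit L α p.1 p.2 T)) hr).trans hδ
    calc ∫ p, Real.exp (excursions L α ε (T + 1 + 1) p) ∂(starProb L)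
        ≤ ∫ p, Real.exp (excursions L α ε (T + 1) p) * Real.exp (2 * δ) ∂(starProb L) := by
          rw [hchange]
          exact integral_mono hcomp.integral_prod_left
            ((integrable_exp_excursions L α ε (T + 1)).mul_const _) hinner
      _ = (∫ p, Real.exp (excursions L α ε (T + 1) p) ∂(starProb L)) * Real.exp (2 * δ) :=
          integral_mul_const _ _
      _ ≤ Real.exp 1 * Real.exp (2 * δ) ^ T * Real.exp (2 * δ) := by gcongr
      _ = _ := by ring

/-- Almost surely, the frequency of excursions is eventually below `d`. -/
lemma ae_eventually_excursions_lt {L : ℕ} (hL : 0 < L) {α : ℝ} (hα : 0 < α) {ε d : ℝ}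
    (hr : 0 ≤ L * ε / α - 18 * α)
    (hd : 2 * (2 * Real.exp (-((L * ε / α - 18 * α) ^ 2 / (2 * L)))) < d) :
    ∀ᵐ p ∂(starProb L), ∀ᶠ T : ℕ in atTop,
      excursions L α ε (T + 1) p < d * ((T + 1 : ℕ) : ℝ) := by
  set δ := 2 * Real.exp (-((L * ε / α - 18 * α) ^ 2 / (2 * L))) with hδ
  have hd0 : 0 < d := lt_trans (by positivity) hd
  have hbound : ∀ T : ℕ, (starProb L).real
      {p | d * ((T + 1 : ℕ) : ℝ) ≤ excursions L α ε (T + 1) p} ≤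
      Real.exp 1 * Real.exp (T * (2 * δ - d)) := by
    intro T
    -- Chernoff with parameter `1`; the resulting geometric bound is summable because `2 * δ < d`,
    -- and Borel–Cantelli applies.
    have h1 := measure_ge_le_exp_mul_mgf (μ := starProb L) (X := excursions L α ε (T + 1))
      (t := 1) (d * ((T + 1 : ℕ) : ℝ)) zero_le_one
      (by simpa using integrable_exp_excursions L α ε (T + 1))
    have h2 := integral_exp_excursions_le hL hα hr hδ.symm.le T
    simp only [mgf, one_mul] at h1
    refine h1.trans ((mul_le_mul_of_nonneg_left h2 (Real.exp_pos _).le).trans ?_)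
    rw [← Real.exp_nat_mul, ← Real.exp_add, ← Real.exp_add, ← Real.exp_add]
    apply Real.exp_le_exp.2
    push_cast
    nlinarith
  have hsum : Summable fun T : ℕ => Real.exp 1 * Real.exp (T * (2 * δ - d)) :=
    (Real.summable_exp_nat_mul_iff.2 (by linarith)).mul_left _
  have hfin : ∑' T : ℕ, (starProb L)
      {p | d * ((T + 1 : ℕ) : ℝ) ≤ excursions L α ε (T + 1) p} ≠ ⊤ := by
    refine ne_top_of_le_ne_top hsum.tsum_ofReal_ne_top (ENNReal.tsum_le_tsum fun T => ?_)
    rw [← ofReal_measureReal]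
    exact ENNReal.ofReal_le_ofReal (hbound T)
  filter_upwards [ae_eventually_notMem hfin] with p hp
  filter_upwards [hp] with T hT
  exact not_le.1 hT

theorem ae_one_sub_le_liminf {L : ℕ} (hL : 0 < L) {α : ℝ} (hα : 0 < α) {ε d : ℝ}
    (hr : 0 ≤ L * ε / α - 18 * α)
    (hd : 2 * (2 * Real.exp (-((L * ε / α - 18 * α) ^ 2 / (2 * L)))) < d) :
    ∀ᵐ p ∂(starProb L), 1 - d ≤ Filter.liminf (fun T : ℕ => (1 / (T : ℝ)) *
      ∑ t ∈ Finset.range T, if |fluct L α t p| ≤ ε then (1 : ℝ) else 0) Filter.atTop := by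
  filter_upwards [ae_eventually_excursions_lt hL hα hr hd] with p hp
  have hsum : ∀ T : ℕ, ∑ t ∈ Finset.range T, (if |fluct L α t p| ≤ ε then (1 : ℝ) else 0) =
      T - excursions L α ε T p := by
    intro T
    rw [excursions, eq_sub_iff_add_eq, ← Finset.sum_add_distrib]
    have : ∀ t ∈ Finset.range T, (if |fluct L α t p| ≤ ε then (1 : ℝ) else 0) +
        {p | ε < |fluct L α t p|}.indicator (fun _ => (1 : ℝ)) p = 1 := by
      intro t _
      by_cases h : |fluct L α t p| ≤ ε
      · simp [indicator, h, not_lt.2 h]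
      · simp [indicator, h, not_le.1 h]
    rw [Finset.sum_congr rfl this]
    simp
  simp_rw [hsum]
  refine le_liminf_of_le ?_ ?_
  -- A real `liminf` is a supremum of eventual lower bounds; the averages must be bounded above for
  -- it not to be a default value.
  · refine IsBoundedUnder.isCoboundedUnder_ge ⟨1, ?_⟩
    rw [eventually_map]
    filter_upwards [eventually_gt_atTop 0] with T hT
    have hT' : (0 : ℝ) < T := by exact_mod_cast hT
    have h0 : 0 ≤ excursions L α ε T p :=
      Finset.sum_nonneg fun t _ => indicator_nonneg (fun _ _ => zero_le_one) p
    rw [one_div, inv_mul_le_iff₀ hT']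
    linarith
  · have hp' : ∀ᶠ T : ℕ in atTop, excursions L α ε T p < d * (T : ℝ) := by
      obtain ⟨N, hN⟩ := eventually_atTop.1 hp
      refine eventually_atTop.2 ⟨N + 1, fun T hT => ?_⟩
      obtain ⟨k, rfl⟩ := Nat.exists_eq_add_of_le' (show 1 ≤ T by omega)
      exact hN k (by omega)
    filter_upwards [hp', eventually_gt_atTop 0] with T hT hT0
    have hT' : (0 : ℝ) < T := by exact_mod_cast hT0
    rw [one_div, le_inv_mul_iff₀ hT']
    linarith

/-! ### Time windows and the choice of constants -/

/-- A union bound over a time window. -/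
lemma le_starProb_forall_abs_fluct_le {L : ℕ} (hL : 0 < L) {α : ℝ} (hα : 0 < α) {ε : ℝ}
    (hr : 0 ≤ L * ε / α - 18 * α) (T t₀ : ℕ) :
    1 - T * (2 * Real.exp (-((L * ε / α - 18 * α) ^ 2 / (2 * L)))) ≤
      (starProb L).real {p | ∀ t ∈ Finset.Ico t₀ (t₀ + T), |fluct L α t p| ≤ ε} := by
  have hcompl : {p | ∀ t ∈ Finset.Ico t₀ (t₀ + T), |fluct L α t p| ≤ ε}ᶜ =
      ⋃ t ∈ Finset.Ico t₀ (t₀ + T), {p | ε < |fluct L α t p|} := by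
    ext p
    simp [and_assoc]
  have hmeas : MeasurableSet {p | ∀ t ∈ Finset.Ico t₀ (t₀ + T), |fluct L α t p| ≤ ε} := by
    rw [← MeasurableSet.compl_iff, hcompl]
    exact Finset.measurableSet_biUnion _ fun t _ => measurableSet_fluct_gt L α ε t
  have h1 := probReal_compl_eq_one_sub (μ := starProb L) hmeas
  rw [hcompl] at h1
  have h2 := measureReal_biUnion_finset_le (μ := starProb L) (Finset.Ico t₀ (t₀ + T))
    fun t => {p | ε < |fluct L α t p|}
  have h3 := Finset.sum_le_sum fun t (_ : t ∈ Finset.Ico t₀ (t₀ + T)) =>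
    starProb_abs_fluct_gt_le hL hα hr t
  simp only [Finset.sum_const, Nat.card_Ico, add_tsub_cancel_left, nsmul_eq_mul] at h3
  linarith

/-- The value `180` makes the coupling error, in the units of the sum, at most a tenth of `√L`. -/
lemma eighteen_mul_le {L : ℕ} {α : ℝ} (hα : 0 < α) (h : 180 ≤ Real.sqrt L / α) :
    18 * α ≤ Real.sqrt L / 10 := by
  rw [le_div_iff₀ hα] at h
  linarith

/-- With `a = ε * √L / α ≥ 10` the threshold is at least `0.99 * a * √L`, so Hoeffding's exponent is
at least `0.49 * a ^ 2`. This exceeds `a ^ 2 / 9 + a ^ 2 / 5`, and the second term absorbs the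
factor `4`. -/
lemma excursion_exponent {L : ℕ} (hL : 0 < L) {α ε : ℝ} (hα : 0 < α)
    (h : 180 ≤ Real.sqrt L / α) (hε : 10 ≤ ε * Real.sqrt L / α) :
    0 ≤ L * ε / α - 18 * α ∧
      2 * (2 * Real.exp (-((L * ε / α - 18 * α) ^ 2 / (2 * L)))) <
        Real.exp (-((L : ℝ) * ε ^ 2 / (9 * α ^ 2))) := by
  have hL' : (0 : ℝ) < L := by exact_mod_cast hL
  have h18 := eighteen_mul_le hα h
  have hq : 0 < Real.sqrt L := Real.sqrt_pos.2 hL'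
  have hqq : Real.sqrt L ^ 2 = L := Real.sq_sqrt hL'.le
  set q := Real.sqrt L
  set a := ε * q / α with ha
  have hr : q * (99 / 100 * a) ≤ L * ε / α - 18 * α := by
    have : L * ε / α = q * a := by rw [ha, ← hqq]; ring
    rw [this]
    nlinarith
  have hr0 : 0 ≤ q * (99 / 100 * a) := by positivity
  refine ⟨hr0.trans hr, ?_⟩
  have h1 : 49 / 100 * a ^ 2 ≤ (L * ε / α - 18 * α) ^ 2 / (2 * L) := by
    rw [le_div_iff₀ (by positivity)]
    have h2 := pow_le_pow_left₀ hr0 hr 2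
    have h3 : (q * (99 / 100 * a)) ^ 2 = L * (9801 / 10000 * a ^ 2) := by rw [← hqq]; ring
    rw [h3] at h2
    nlinarith [mul_nonneg hL'.le (sq_nonneg a)]
  have h4 : (L : ℝ) * ε ^ 2 / (9 * α ^ 2) = a ^ 2 / 9 := by
    rw [ha, ← hqq]
    field_simp
  rw [h4]
  have h5 : Real.exp (-((L * ε / α - 18 * α) ^ 2 / (2 * L))) ≤
      Real.exp (-(a ^ 2 / 9)) * Real.exp (-(a ^ 2 / 5)) := by
    rw [← Real.exp_add]
    apply Real.exp_le_exp.2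
    nlinarith [sq_nonneg a]
  have h6 : 4 * Real.exp (-(a ^ 2 / 5)) < 1 := by
    rw [Real.exp_neg, ← div_eq_mul_inv, div_lt_one (Real.exp_pos _)]
    have := Real.add_one_le_exp (a ^ 2 / 5)
    nlinarith
  have h7 := Real.exp_pos (-(a ^ 2 / 9))
  nlinarith

/-- Put `b = L ^ (1 - κ) ≥ √L` and `m = L ^ (1 - 2 * κ) ≥ 1`, so `b ^ 2 = L * m`. The threshold is
at least `2.9 * b`, hence the exponent at least `4 * m`, while `T ≤ 2 * exp m`. The union bound is
then at most `4 * exp (-(3 * m)) ≤ exp (-m)`. -/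
lemma window_exponent {L : ℕ} (hL : 0 < L) {α κ : ℝ} (hα : 0 < α)
    (h : 180 ≤ Real.sqrt L / α) (hκ : κ < 1 / 2) {T : ℕ}
    (hT : T ≤ ⌈Real.exp ((L : ℝ) ^ (1 - 2 * κ))⌉₊) :
    0 ≤ L * (3 * (L : ℝ) ^ (-κ) * α) / α - 18 * α ∧
      T * (2 * Real.exp (-((L * (3 * (L : ℝ) ^ (-κ) * α) / α - 18 * α) ^ 2 / (2 * L)))) ≤
        Real.exp (-((L : ℝ) ^ (1 - 2 * κ))) := by
  have hL' : (0 : ℝ) < L := by exact_mod_cast hL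
  have hL1 : (1 : ℝ) ≤ L := by exact_mod_cast hL
  have h18 := eighteen_mul_le hα h
  set b := (L : ℝ) ^ (1 - κ) with hb
  set m := (L : ℝ) ^ (1 - 2 * κ) with hm
  have hb0 : 0 < b := Real.rpow_pos_of_pos hL' _
  have hm1 : 1 ≤ m := Real.one_le_rpow hL1 (by linarith)
  have hqb : Real.sqrt L ≤ b := by
    rw [Real.sqrt_eq_rpow, hb]
    exact Real.rpow_le_rpow_of_exponent_le hL1 (by linarith)
  have hbb : b ^ 2 = L * m := by
    rw [hb, hm, ← Real.rpow_natCast, ← Real.rpow_mul hL'.le]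
    nth_rewrite 2 [← Real.rpow_one (L : ℝ)]
    rw [← Real.rpow_add hL']
    congr 1
    push_cast
    ring
  have he : L * (3 * (L : ℝ) ^ (-κ) * α) / α = 3 * b := by
    have : b = L * (L : ℝ) ^ (-κ) := by
      rw [hb, sub_eq_add_neg, Real.rpow_add hL', Real.rpow_one]
    rw [this]
    field_simp
  rw [he]
  have hr : 29 / 10 * b ≤ 3 * b - 18 * α := by linarith
  refine ⟨by linarith, ?_⟩
  have h1 : 4 * m ≤ (3 * b - 18 * α) ^ 2 / (2 * L) := by
    rw [le_div_iff₀ (by positivity)]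
    have h2 := pow_le_pow_left₀ (by positivity) hr 2
    nlinarith [mul_nonneg hL'.le (zero_le_one.trans hm1)]
  have hT' : (T : ℝ) ≤ 2 * Real.exp m := by
    have h2 : (T : ℝ) ≤ (⌈Real.exp m⌉₊ : ℝ) := by exact_mod_cast hT
    have h3 := Nat.ceil_lt_add_one (Real.exp_pos m).le
    have h4 := Real.add_one_le_exp m
    linarith
  have h5 : Real.exp (-((3 * b - 18 * α) ^ 2 / (2 * L))) ≤ Real.exp (-(4 * m)) :=
    Real.exp_le_exp.2 (by linarith)
  have h6 : 4 * Real.exp (-(2 * m)) ≤ 1 := by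
    rw [Real.exp_neg, ← div_eq_mul_inv, div_le_one (Real.exp_pos _), two_mul, Real.exp_add]
    have := Real.add_one_le_exp m
    nlinarith
  calc T * (2 * Real.exp (-((3 * b - 18 * α) ^ 2 / (2 * L))))
      ≤ 2 * Real.exp m * (2 * Real.exp (-(4 * m))) := by gcongr
    _ = 4 * Real.exp (-(2 * m)) * Real.exp (-m) := by
        rw [show -(4 * m) = -(2 * m) + (-m) + (-m) by ring, Real.exp_add, Real.exp_add,
          Real.exp_neg m]
        field_simp
        norm_num
    _ ≤ Real.exp (-m) := mul_le_of_le_one_left (Real.exp_pos _).le h6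

end

end StarNetwork

theorem theoremA :
    ∃ C₁ C₂ C₃ : ℝ, 0 < C₁ ∧ 0 < C₂ ∧ 0 < C₃ ∧
      ∀ (L : ℕ) (α : ℝ), 0 < α → C₁ ≤ (L : ℝ) → C₂ ≤ Real.sqrt (L : ℝ) / α →
        -- the hub follows the mean-field reduced map up to the fluctuation
        (∀ (p : StarNetwork.Noise L × StarNetwork.State L) (t : ℕ),
          StarNetwork.orbit L α p.1 p.2 (t + 1) 0 =
            StarNetwork.reducedMap α (p.1 (t, 0)) (StarNetwork.orbit L α p.1 p.2 t 0) +
              ((StarNetwork.fluct L α t p : ℝ) : UnitAddCircle)) ∧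
        -- (i)
        (∀ ε : ℝ, C₃ ≤ ε * Real.sqrt (L : ℝ) / α →
          ∀ᵐ p ∂(StarNetwork.starProb L),
            1 - Real.exp (-((L : ℝ) * ε ^ 2 / (9 * α ^ 2))) ≤
              Filter.liminf (fun T : ℕ => (1 / (T : ℝ)) *
                ∑ t ∈ Finset.range T, if |StarNetwork.fluct L α t p| ≤ ε then (1 : ℝ) else 0)
                Filter.atTop) ∧
        -- (ii)
        (∀ κ : ℝ, 0 < κ → κ < 1 / 2 → ∀ T t₀ : ℕ,
          T ≤ ⌈Real.exp ((L : ℝ) ^ (1 - 2 * κ))⌉₊ →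
          1 - Real.exp (-((L : ℝ) ^ (1 - 2 * κ))) ≤
            (StarNetwork.starProb L).real {p | ∀ t ∈ Finset.Ico t₀ (t₀ + T),
              |StarNetwork.fluct L α t p| ≤ 3 * (L : ℝ) ^ (-κ) * α}) ∧
        -- (iii)
        (∀ (t : ℕ) (s : ℝ),
          (StarNetwork.starProb L).real {p | StarNetwork.fluct L α t p ≤ s} ∈
            Set.Icc
              (ProbabilityTheory.cdf
                (ProbabilityTheory.gaussianReal 0 (Real.toNNReal (α ^ 2 / (2 * (L : ℝ)))))
                (s - 36 * α ^ 2 / (L : ℝ)) - 8 / Real.sqrt (L : ℝ))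
              (ProbabilityTheory.cdf
                (ProbabilityTheory.gaussianReal 0 (Real.toNNReal (α ^ 2 / (2 * (L : ℝ)))))
                (s + 36 * α ^ 2 / (L : ℝ)) + 8 / Real.sqrt (L : ℝ))) := by
  -- `1` only ensures `L > 0`; `180 = 10 * 18` controls the coupling error; `10` is the lower bound
  -- on `a` in `excursion_exponent`.
  refine ⟨1, 180, 10, by norm_num, by norm_num, by norm_num, fun L α hα hL1 hL2 => ?_⟩
  have hL : 0 < L := by
    have : (0 : ℝ) < L := by linarith
    exact_mod_cast this
  refine ⟨StarNetwork.orbit_succ_hub hL α, fun ε hε => ?_, fun κ _ hκ T t₀ hT => ?_,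
    StarNetwork.starProb_fluct_le_mem_Icc hL hα⟩
  · obtain ⟨hr, hd⟩ := StarNetwork.excursion_exponent hL hα hL2 hε
    exact StarNetwork.ae_one_sub_le_liminf hL hα hr hd
  · obtain ⟨hr, hd⟩ := StarNetwork.window_exponent hL hα hL2 hκ hT
    have := StarNetwork.le_starProb_forall_abs_fluct_le hL hα hr T t₀
    linarith
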